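/- Let $H=U=L^2[0,\pi]$ (real), $e_m(s)=\sqrt{2/\pi}\,\sin(ms)$ for $m\ge 1$, and let $A y=y''$ with domain $D(A)=\{y\in H: y,y' \text{ absolutely continuous},\ y''\in H,\ y(0)=y(\pi)=0\}$. Put $S(t)y=\sum_{m\ge1}e^{-m^2t}\langle y,e_m\rangle e_m$ and, with $\alpha=\tfrac23$ and the Wright function $\Psi_\alpha(\theta)=\sum_{n\ge0}\frac{(-\theta)^n}{n!\,\Gamma(-\alpha n+1-\alpha)}$, $$\mathcal S(t)=\int_0^\infty\Psi_\alpha(\theta)S(t^\alpha\theta)\,d\theta,\qquad \mathcal P(t)=\int_0^\infty\alpha\theta\,\Psi_\alpha(\theta)S(t^\alpha\theta)\,d\theta .$$ For $u\in L^2([0,1],U)$ let $Bu(t)=B(t)u(t)$, where $B(t)w=\sum_{m\ge1,\ 1-1/m^2\le t}\langle w,e_m\rangle e_m$. Consider the impulsive fractional heat equation with Dirichlet conditions $${}^{C}D^{2/3}_{t_k^+}y(t)=Ay(t)+Bu(t)\ \ (t\in[0,1]\setminus\{\tfrac12\}),\qquad \Delta y(t_k)=y(t_k)+v_k\ \ (k=1,2),\qquad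 y(0)=y_0,$$ with $t_0=0$, $t_1=\tfrac12$, $t_2=1$ and the convention $y(t_k)=y(t_k^-)$ (that is, $D_1=D_2=E_1=E_2=I$). Its mild solution is given by $y(t_0^+)=y_0$, $y(t)=\mathcal S(t-t_k)y(t_k^+)+\int_{t_k}^t(t-s)^{-1/3}\mathcal P(t-s)Bu(s)\,ds$ for $t_k<t\le t_{k+1}$ ($k=0,1$), and $y(t_k^+)=2y(t_k)+v_k$ ($k=1,2$). Its controllability operator $\mathcal M:L^2([0,1],U)\times U^2\to H$ sends $(u,v_1,v_2)$ to the final state $y(1^+)$ reached from $y_0=0$, that is $$\mathcal M(u,v_1,v_2)=2\int_{1/2}^1(1-s)^{-1/3}\mathcal P(1-s)Bu(s)\,ds+4\,\mathcal S(\tfrac12)\int_0^{1/2}(\tfrac12-s)^{-1/3}\mathcal P(\tfrac12-s)Bu(s)\,ds+2\,\mathcal S(\tfrac12)v_1+v_2 .$$ The system is called approximately controllable on $[0,1]$ if $\overline{\operatorname{Im}\mathcal M}=H$. Then: (a) $S$ is a strongly continuous semigroup of bounded operators, and its generator is $A$. (b) Each $B(t)$ is bounded and linear with $\|B(t)w\|\le\|w\|$.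 (c) $\mathcal M$ is bounded and linear, $\mathcal M^*h=0$ implies $h=0$ for $h\in H$, and the system is approximately controllable on $[0,1]$. (d) The same holds (bounded and linear, adjoint injective, image dense) for the operator $$\int_{1/2}^1(1-s)^{-1/3}\mathcal P(1-s)Bu(s)\,ds+2\,\mathcal S(\tfrac12)\int_0^{1/2}(\tfrac12-s)^{-1/3}\mathcal P(\tfrac12-s)Bu(s)\,ds+\mathcal S(\tfrac12)v_1+v_2 .$$ (e) If the impulses are fixed to be $v_1=\sin$ and $v_2=\cos$, then for every $y_0\in H$ the states $y(1)$, and likewise the states $y(1^+)$, that are reached as $u$ ranges over $L^2([0,1],U)$ form a dense subset of $H$. -/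

import Mathlib

open MeasureTheory Set Filter Topology

noncomputable section

/-- The Wright function `Ψ_α`. At the poles of `Γ` the value `1 / Γ = 0` is the correct one. -/
def wright (α θ : ℝ) : ℝ :=
  ∑' n : ℕ, (-θ) ^ n / ((n.factorial : ℝ) * Real.Gamma (-α * n + 1 - α))

/-- The space of controls `(u, (v_k)_k)`, that is `L²([0, b], U) × Uⁿ` with its Hilbert structure. -/
abbrev ControlSpace (U : Type*) [NormedAddCommGroup U] [InnerProductSpace ℝ U] (n : ℕ) (b : ℝ) :=
  WithLp 2 (Lp U 2 (volume.restrict (Icc (0 : ℝ) b)) × PiLp 2 (fun _ : Fin n => U))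

section Abstract

variable {H U : Type*} [NormedAddCommGroup H] [InnerProductSpace ℝ H]
  [NormedAddCommGroup U] [InnerProductSpace ℝ U]

/-- `S` is a strongly continuous semigroup of bounded linear operators (only `t ≥ 0` matters). -/
def IsC0Semigroup (S : ℝ → H → H) : Prop :=
  (∀ t, 0 ≤ t → IsBoundedLinearMap ℝ (S t)) ∧
  (∀ t s, 0 ≤ t → 0 ≤ s → ∀ x, S (t + s) x = S t (S s x)) ∧
  (∀ x, S 0 x = x) ∧
  (∀ x, Tendsto (fun t => S t x) (𝓝[>] 0) (𝓝 x))

/-- The relation `A` (`A x z` meaning `x ∈ D(A)` and `A x = z`) is the graph of the infinitesimal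
generator of `S`. -/
def IsGeneratorOf (A : H → H → Prop) (S : ℝ → H → H) : Prop :=
  ∀ x z, A x z ↔ Tendsto (fun t : ℝ => t⁻¹ • (S t x - x)) (𝓝[>] 0) (𝓝 z)

/-- The operator `𝒮_α(t) = ∫₀^∞ Ψ_α(θ) S(t^α θ) dθ`, as a strong integral. -/
def fracS (S : ℝ → H → H) (α t : ℝ) (x : H) : H :=
  ∫ θ in Ioi (0 : ℝ), wright α θ • S (t ^ α * θ) x

/-- The operator `𝒫_α(t) = ∫₀^∞ α θ Ψ_α(θ) S(t^α θ) dθ`, as a strong integral. -/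
def fracP (S : ℝ → H → H) (α t : ℝ) (x : H) : H :=
  ∫ θ in Ioi (0 : ℝ), (α * θ * wright α θ) • S (t ^ α * θ) x

/-- The data of the impulsive system
`ᶜD^α_{t_k+} x(t) = A x(t) + B(t) u(t)`, `Δx(t_k) = D_k x(t_k) + E_k v_k` on `[0, b]`, where `S` is
the semigroup generated by `A`, `time 0 = 0`, and `time k` for `k ≥ 1` are the `n` impulse times;
`D k`, `E k` for `k : Fin n` belong to the impulse at `time k.succ`. -/
structure FracImpulsiveSystem (H U : Type*) [NormedAddCommGroup H] [InnerProductSpace ℝ H]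
    [NormedAddCommGroup U] [InnerProductSpace ℝ U] (n : ℕ) (b : ℝ) where
  order : ℝ
  S : ℝ → H → H
  B : ℝ → U → H
  time : Fin (n + 1) → ℝ
  D : Fin n → H →L[ℝ] H
  E : Fin n → U →L[ℝ] H

namespace FracImpulsiveSystem

variable {n : ℕ} {b : ℝ} (sys : FracImpulsiveSystem H U n b)

/-- Between impulses: the mild solution at time `t`, started at time `τ` from the state `x`,
`𝒮_α(t - τ) x + ∫_τ^t (t - s)^(α - 1) 𝒫_α(t - s) B(s) u(s) ds`. -/
def evolve (u : ℝ → U) (τ t : ℝ) (x : H) : H :=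
  fracS sys.S sys.order (t - τ) x +
    ∫ s in τ..t, (t - s) ^ (sys.order - 1) • fracP sys.S sys.order (t - s) (sys.B s (u s))

/-- The states `x(t_k⁺)`: `x(t_0⁺) = x₀` and `x(t_{k+1}⁺) = (I + D_{k+1}) x(t_{k+1}) + E_{k+1} v_{k+1}`,
where `x(t_{k+1}) = x(t_{k+1}⁻)` is reached from `x(t_k⁺)`. -/
def postImpulse (x₀ : H) (u : ℝ → U) (v : Fin n → U) : Fin (n + 1) → H :=
  Fin.induction (motive := fun _ => H) x₀ fun k x =>
    evolve sys u (sys.time k.castSucc) (sys.time k.succ) x +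
      sys.D k (evolve sys u (sys.time k.castSucc) (sys.time k.succ) x) + sys.E k (v k)

/-- The mild solution on `(t_k, t_{k+1}]`, with `t_{n+1} = b`. -/
def mildSolution (x₀ : H) (u : ℝ → U) (v : Fin n → U) (k : Fin (n + 1)) (t : ℝ) : H :=
  evolve sys u (sys.time k) t (postImpulse sys x₀ u v k)

/-- The controllability map `ℳ(u, v)`: the final state, all impulses having taken place, that the
controls produce from the initial state `0`. -/
def controllabilityMap (Ω : ControlSpace U n b) : H :=
  mildSolution sys 0 (Ω.fst : ℝ → U) (fun k => Ω.snd k) (Fin.last n) b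

/-- Approximate controllability on `[0, b]`: the image of `ℳ` is dense. -/
def ApproximatelyControllable : Prop :=
  closure (range (controllabilityMap sys)) = univ

end FracImpulsiveSystem

end Abstract

/-- `L²[0, π]`, real-valued. -/
abbrev L2Pi := Lp ℝ 2 (volume.restrict (Icc (0 : ℝ) Real.pi))

/-- The class in `L²[0, π]` of a continuous function. -/
def contL2 (f : ℝ → ℝ) (hf : Continuous f) : L2Pi :=
  MemLp.toLp f (by
    obtain ⟨C, hC⟩ := (isCompact_Icc (a := (0 : ℝ)) (b := Real.pi)).exists_bound_of_continuousOn
      hf.continuousOn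
    exact MemLp.of_bound hf.aestronglyMeasurable C
      ((ae_restrict_iff' measurableSet_Icc).2 (Eventually.of_forall hC)))

/-- `sineMode n` is `e_{n+1}`, where `e_m(s) = √(2/π) sin (m s)`. -/
def sineMode (n : ℕ) : L2Pi :=
  contL2 (fun s => Real.sqrt (2 / Real.pi) * Real.sin (((n : ℝ) + 1) * s)) (by fun_prop)

/-- `heatSemigroup t y = ∑_{m ≥ 1} exp (-m² t) ⟨y, e_m⟩ e_m`. -/
def heatSemigroup (t : ℝ) (y : L2Pi) : L2Pi :=
  ∑' n : ℕ, (Real.exp (-((n : ℝ) + 1) ^ 2 * t) * inner ℝ (sineMode n) y) • sineMode n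

/-- The graph of the Dirichlet Laplacian `A y = y''` on `L²[0, π]`: `y` has a representative `f`
with `f`, `f'` absolutely continuous on `[0, π]`, `f(0) = f(π) = 0`, and `z = f''` almost
everywhere (so `f'' ∈ L²`). -/
def dirichletLaplacian (y z : L2Pi) : Prop :=
  ∃ f f' : ℝ → ℝ,
    AbsolutelyContinuousOnInterval f 0 Real.pi ∧
    AbsolutelyContinuousOnInterval f' 0 Real.pi ∧
    (∀ s ∈ Icc (0 : ℝ) Real.pi, HasDerivWithinAt f (f' s) (Icc 0 Real.pi) s) ∧
    (∀ᵐ s ∂(volume.restrict (Icc (0 : ℝ) Real.pi)), HasDerivAt f' (z s) s) ∧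
    f 0 = 0 ∧ f Real.pi = 0 ∧
    (∀ᵐ s ∂(volume.restrict (Icc (0 : ℝ) Real.pi)), y s = f s)

open Classical in
/-- The time-windowed diagonal operator: `windowB t w` is the sum of `⟨w, e_m⟩ e_m` over those
`m ≥ 1` with `1 - 1 / m² ≤ t`. -/
def windowB (t : ℝ) (w : L2Pi) : L2Pi :=
  ∑' n : ℕ, if 1 - 1 / ((n : ℝ) + 1) ^ 2 ≤ t then inner ℝ (sineMode n) w • sineMode n else 0

/-- The impulsive fractional heat equation: `α = 2/3`, `b = 1`, `t₁ = 1/2`, `t₂ = 1`,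
`D₁ = D₂ = E₁ = E₂ = I`. -/
def heatSystem : FracImpulsiveSystem L2Pi L2Pi 2 1 where
  order := 2 / 3
  S := heatSemigroup
  B := windowB
  time := ![0, 1 / 2, 1]
  D := fun _ => ContinuousLinearMap.id ℝ L2Pi
  E := fun _ => ContinuousLinearMap.id ℝ L2Pi

/-- The explicit operator
`∫_{1/2}^1 (1-s)^(-1/3) 𝒫(1-s) B u(s) ds + 2 𝒮(1/2) ∫_0^{1/2} (1/2-s)^(-1/3) 𝒫(1/2-s) B u(s) ds
  + 𝒮(1/2) v₁ + v₂`, with `𝒮 = 𝒮_{2/3}`, `𝒫 = 𝒫_{2/3}`. -/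
def heatExplicitMap (Ω : ControlSpace L2Pi 2 1) : L2Pi :=
  (∫ s in (1 / 2 : ℝ)..1, (1 - s) ^ (-(1 / 3) : ℝ) •
      fracP heatSemigroup (2 / 3) (1 - s) (windowB s (Ω.fst s))) +
    (2 : ℝ) • fracS heatSemigroup (2 / 3) (1 / 2)
      (∫ s in (0 : ℝ)..(1 / 2), (1 / 2 - s) ^ (-(1 / 3) : ℝ) •
        fracP heatSemigroup (2 / 3) (1 / 2 - s) (windowB s (Ω.fst s))) +
    fracS heatSemigroup (2 / 3) (1 / 2) (Ω.snd 0) + Ω.snd 1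

end

/-!
Everything is diagonal in the sine basis `e_m` of `L²[0, π]`. The basis is total because `sin (m s)`
spans the functions `sin s · p (cos s)` with `p` a polynomial
(`ae_eq_zero_of_integral_sin_eq_zero`). The generator is identified in coordinates: two integrations
by parts give `⟨e_m, y''⟩ = -m² ⟨e_m, y⟩` on the domain (`inner_sineMode_of_dirichletLaplacian`),
and every right-hand side has a preimage (`exists_dirichletLaplacian`), so convergence of the
difference quotients forces membership in the domain.

The operators `𝒮(t)` and `𝒫(t)` are only meaningful if `Ψ_α` and `θ Ψ_α` are integrable on
`(0, ∞)`. This is proved for all `0 < α < 1`. Euler's reflection formula and a Gamma integral along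
a rotated ray turn the Wright series into an absolutely convergent integral (`hasSum_wrightGen`).
Fubini then gives the Mellin transform (`mellin_wrightGen`), from which `∫ Ψ_α = 1` and
`∫ α θ Ψ_α = 1 / Γ(α)`. The first identity means that `𝒮(0)` is the identity, so the controllability
map, whose last evolution step has length zero, is the state after the second impulse.

The control integrals are bounded on `L²` because `(t - s) ^ (-1/3)` is square integrable and the
norms of `𝒫` and `B` are bounded. Since `v₂` enters both operators by plain addition, they are onto,
hence have dense range and injective adjoint (`exists_controllability_CLM`). With the impulses
fixed, density rests on the control `u` alone: the mode `e_m` becomes active at the time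
`1 - 1 / m² < 1`, and a control along `e_m` on a short interval before `1` reaches a nonzero
multiple of `e_m` because the eigenvalue of `𝒫(t)` tends to `1 / Γ(α) > 0` as `t → 0`
(`exists_control_reaching_sineMode`).
-/

/-! ### The Gamma integral with a complex rate -/

lemma integrableOn_rpow_mul_exp_neg_mul {a b : ℝ} (ha : 0 < a) (hb : 0 < b) :
    IntegrableOn (fun t : ℝ => t ^ (a - 1) * Real.exp (-b * t)) (Ioi 0) := by
  simpa using integrableOn_rpow_mul_exp_neg_mul_rpow (p := 1) (s := a - 1) (b := b)
    (by linarith) one_pos hb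

lemma norm_rpow_mul_cexp_neg_mul (a : ℝ) (z : ℂ) {t : ℝ} (ht : t ∈ Ioi (0 : ℝ)) :
    ‖((t ^ (a - 1) : ℝ) : ℂ) * Complex.exp (-(z * t))‖ =
      t ^ (a - 1) * Real.exp (-z.re * t) := by
  have ht' : 0 < t := ht
  rw [norm_mul, Complex.norm_real, Complex.norm_exp, Real.norm_of_nonneg (by positivity)]
  simp

lemma aestronglyMeasurable_rpow_mul_cexp_neg_mul (a : ℝ) (z : ℂ) :
    AEStronglyMeasurable (fun t : ℝ => ((t ^ (a - 1) : ℝ) : ℂ) * Complex.exp (-(z * t)))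
      (volume.restrict (Ioi (0 : ℝ))) := by
  apply Measurable.aestronglyMeasurable
  fun_prop

lemma integrableOn_rpow_mul_cexp_neg_mul {a : ℝ} (ha : 0 < a) {z : ℂ} (hz : 0 < z.re) :
    IntegrableOn (fun t : ℝ => ((t ^ (a - 1) : ℝ) : ℂ) * Complex.exp (-(z * t))) (Ioi 0) := by
  refine (integrableOn_rpow_mul_exp_neg_mul ha hz).mono'
    (aestronglyMeasurable_rpow_mul_cexp_neg_mul a z) ?_
  filter_upwards [ae_restrict_mem measurableSet_Ioi] with t ht
  exact (norm_rpow_mul_cexp_neg_mul a z ht).le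

lemma differentiableOn_integral_rpow_mul_cexp_neg_mul {a : ℝ} (ha : 0 < a) :
    DifferentiableOn ℂ
      (fun z : ℂ => ∫ t in Ioi (0 : ℝ), ((t ^ (a - 1) : ℝ) : ℂ) * Complex.exp (-(z * t)))
      {z | 0 < z.re} := by
  intro z hz
  have hz' : 0 < z.re := hz
  have hs : {w : ℂ | z.re / 2 < w.re} ∈ 𝓝 z :=
    (isOpen_lt continuous_const Complex.continuous_re).mem_nhds (by simp; linarith)
  refine (hasDerivAt_integral_of_dominated_loc_of_deriv_le
    (F := fun (w : ℂ) (t : ℝ) => ((t ^ (a - 1) : ℝ) : ℂ) * Complex.exp (-(w * t)))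
    (F' := fun (w : ℂ) (t : ℝ) =>
      ((t ^ (a - 1) : ℝ) : ℂ) * (Complex.exp (-(w * t)) * (-(1 * (t : ℂ)))))
    (bound := fun t : ℝ => t ^ (a + 1 - 1) * Real.exp (-(z.re / 2) * t))
    hs (Eventually.of_forall fun w => aestronglyMeasurable_rpow_mul_cexp_neg_mul a w)
    (integrableOn_rpow_mul_cexp_neg_mul ha hz') ?_ ?_
    (integrableOn_rpow_mul_exp_neg_mul (by linarith) (by linarith))
    ?_).2.differentiableAt.differentiableWithinAt
  · apply Measurable.aestronglyMeasurable
    fun_prop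
  · filter_upwards [ae_restrict_mem measurableSet_Ioi] with t ht w hw
    have ht' : 0 < t := ht
    have hw' : z.re / 2 < w.re := hw
    rw [← mul_assoc, norm_mul, norm_rpow_mul_cexp_neg_mul a w ht, one_mul, norm_neg,
      Complex.norm_real, Real.norm_of_nonneg ht'.le,
      show a + 1 - 1 = (a - 1) + 1 by ring, Real.rpow_add_one ht'.ne']
    have : Real.exp (-w.re * t) ≤ Real.exp (-(z.re / 2) * t) := by
      apply Real.exp_le_exp.2; nlinarith
    calc t ^ (a - 1) * Real.exp (-w.re * t) * t
        = t ^ (a - 1) * t * Real.exp (-w.re * t) := by ring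
      _ ≤ _ := by gcongr
  · refine Eventually.of_forall fun t w _ => ?_
    exact (((hasDerivAt_id w).mul_const (t : ℂ)).neg.cexp).const_mul _

/-- Euler's integral `∫ t ^ (a - 1) e ^ (-z t) dt = Γ(a) z ^ (-a)` for a rate `z` in the right half
plane: both sides are holomorphic in `z` and agree for `z > 0`. -/
lemma integral_rpow_mul_cexp_neg_mul_Ioi {a : ℝ} (ha : 0 < a) {z : ℂ} (hz : 0 < z.re) :
    ∫ t in Ioi (0 : ℝ), ((t ^ (a - 1) : ℝ) : ℂ) * Complex.exp (-(z * t)) =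
      Real.Gamma a * z ^ (-a : ℂ) := by
  have hopen : IsOpen {z : ℂ | 0 < z.re} := isOpen_lt continuous_const Complex.continuous_re
  have hf := (differentiableOn_integral_rpow_mul_cexp_neg_mul ha).analyticOnNhd hopen
  have hg : AnalyticOnNhd ℂ (fun z : ℂ => (Real.Gamma a : ℂ) * z ^ (-a : ℂ)) {z | 0 < z.re} := by
    apply DifferentiableOn.analyticOnNhd _ hopen
    intro z hz
    exact ((differentiableAt_id.cpow_const (Or.inl hz)).const_mul _).differentiableWithinAt
  have hconv : IsPreconnected {z : ℂ | 0 < z.re} :=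
    (convex_halfSpace_re_gt 0).isPreconnected
  refine hf.eqOn_of_preconnected_of_frequently_eq hg hconv (z₀ := 1) (by simp) ?_ hz
  have hreal : ∀ r : ℝ, 0 < r →
      ∫ t in Ioi (0 : ℝ), ((t ^ (a - 1) : ℝ) : ℂ) * Complex.exp (-((r : ℂ) * t)) =
        Real.Gamma a * (r : ℂ) ^ (-a : ℂ) := by
    intro r hr
    have h := Real.integral_rpow_mul_exp_neg_mul_Ioi ha hr
    rw [← Complex.ofReal_neg, ← Complex.ofReal_cpow hr.le, Real.rpow_neg hr.le]
    rw [Real.div_rpow zero_le_one hr.le, Real.one_rpow, one_div, mul_comm] at h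
    rw [← Complex.ofReal_mul, ← h, ← integral_complex_ofReal]
    simp
  have hlim : Tendsto (fun n : ℕ => ((1 + 1 / ((n : ℝ) + 1) : ℝ) : ℂ)) atTop (𝓝[≠] 1) := by
    refine tendsto_nhdsWithin_iff.2 ⟨?_, Eventually.of_forall fun n => ?_⟩
    · have h := (tendsto_one_div_add_atTop_nhds_zero_nat (𝕜 := ℝ)).const_add 1
      rw [add_zero] at h
      exact (Complex.continuous_ofReal.tendsto 1).comp h
    · have : (1 + 1 / ((n : ℝ) + 1) : ℝ) ≠ 1 := by
        have : (0 : ℝ) < 1 / ((n : ℝ) + 1) := by positivity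
        linarith
      exact fun h => this (Complex.ofReal_injective h)
  exact hlim.frequently (Eventually.of_forall fun n => hreal _ (by positivity)).frequently

/-- Polar form: the rate is `ρ e ^ (i φ)` with `|φ| < π / 2`. -/
lemma integral_rpow_mul_cexp_neg_polar_Ioi {a ρ φ : ℝ} (ha : 0 < a) (hρ : 0 < ρ)
    (hφ : φ ∈ Ioo (-(Real.pi / 2)) (Real.pi / 2)) :
    ∫ t in Ioi (0 : ℝ), ((t ^ (a - 1) : ℝ) : ℂ) *
        Complex.exp (-(((ρ : ℂ) * Complex.exp (φ * Complex.I)) * t)) =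
      (Real.Gamma a * ρ ^ (-a) : ℝ) * Complex.exp (-(a * φ) * Complex.I) := by
  have hπ := Real.pi_pos
  have hre : 0 < ((ρ : ℂ) * Complex.exp (φ * Complex.I)).re := by
    rw [Complex.re_ofReal_mul, Complex.exp_ofReal_mul_I_re]
    exact mul_pos hρ (Real.cos_pos_of_mem_Ioo hφ)
  rw [integral_rpow_mul_cexp_neg_mul_Ioi ha hre]
  have hρ' : (ρ : ℂ) = Complex.exp (Real.log ρ : ℝ) := by
    rw [← Complex.ofReal_exp, Real.exp_log hρ]
  have hlog : Complex.log ((ρ : ℂ) * Complex.exp (φ * Complex.I)) =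
      (Real.log ρ : ℝ) + φ * Complex.I := by
    rw [hρ', ← Complex.exp_add]
    refine Complex.log_exp ?_ ?_
    · simpa using by linarith [hφ.1]
    · simpa using by linarith [hφ.2]
  have hne : (ρ : ℂ) * Complex.exp (φ * Complex.I) ≠ 0 := by
    intro h
    rw [h] at hre
    simp at hre
  rw [Complex.cpow_def_of_ne_zero hne, hlog, Real.rpow_def_of_pos hρ]
  push_cast
  rw [mul_assoc, ← Complex.exp_add]
  congr 2
  ring

/-! ### The Wright function on the half line -/

/-- The two-parameter Wright function `∑ (-θ) ^ n / (n! Γ(β - α n))`; the function `Ψ_α` is the case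
`β = 1 - α`. At the poles of `Γ` the junk value `1 / Γ = 0` is the correct one. -/
noncomputable def wrightGen (α β θ : ℝ) : ℝ :=
  ∑' n : ℕ, (-θ) ^ n / ((n.factorial : ℝ) * Real.Gamma (β - α * n))

lemma wright_eq_wrightGen (α θ : ℝ) : wright α θ = wrightGen α (1 - α) θ := by
  simp only [wright, wrightGen]
  refine tsum_congr fun n => ?_
  rw [show -α * n + 1 - α = 1 - α - α * n by ring]

/-- Euler's reflection formula in a form that stays true at the poles of `Γ`. -/
lemma inv_Gamma_eq {s : ℝ} (hs : s < 1) :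
    (Real.Gamma s)⁻¹ = Real.pi⁻¹ * (Real.Gamma (1 - s) * Real.sin (Real.pi * (1 - s))) := by
  have h := Real.Gamma_mul_Gamma_one_sub s
  have hsin : Real.sin (Real.pi * (1 - s)) = Real.sin (Real.pi * s) := by
    rw [mul_sub, mul_one, Real.sin_pi_sub]
  have hG : Real.Gamma (1 - s) ≠ 0 := (Real.Gamma_pos_of_pos (by linarith)).ne'
  rw [hsin]
  by_cases h0 : Real.sin (Real.pi * s) = 0
  · rw [h0, div_zero] at h
    rw [(mul_eq_zero.1 h).resolve_right hG, h0]
    simp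
  · have hs' : Real.Gamma s ≠ 0 := by
      intro h'
      rw [h', zero_mul] at h
      exact (div_ne_zero Real.pi_ne_zero h0) h.symm
    have hπ := Real.pi_ne_zero
    rw [eq_div_iff h0] at h
    refine inv_eq_of_mul_eq_one_right ?_
    rw [show Real.Gamma s * (Real.pi⁻¹ * (Real.Gamma (1 - s) * Real.sin (Real.pi * s))) =
      Real.pi⁻¹ * (Real.Gamma s * Real.Gamma (1 - s) * Real.sin (Real.pi * s)) by ring, h,
      inv_mul_cancel₀ hπ]

/-- The integrand `r ^ (-β) exp (-ζ r - θ w r ^ α)` with `ζ = e ^ (i (ψ - π))` and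
`w = e ^ (i α ψ)` of the Hankel integral of the Wright function, parametrized along the ray of
argument `ψ`. For `π / 2 < ψ < π` and `α ψ < π / 2` both `ζ` and `w` have positive real part. -/
noncomputable def wrightKernel (α β ψ θ r : ℝ) : ℂ :=
  ((r ^ (-β) : ℝ) : ℂ) * Complex.exp (-(Complex.exp ((ψ - Real.pi : ℝ) * Complex.I) * r)) *
    Complex.exp (-((θ * r ^ α : ℝ) * Complex.exp ((α * ψ : ℝ) * Complex.I)))

/-- `θ r ^ α` is dominated by a linear function of `r`, with arbitrarily small slope. -/
lemma exists_mul_rpow_le {α θ c : ℝ} (hα0 : 0 < α) (hα : α < 1) (hθ : 0 < θ) (hc : 0 < c) :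
    ∃ K, ∀ r, 0 < r → θ * r ^ α ≤ K + c * r := by
  have h1 : 0 < 1 - α := by linarith
  refine ⟨θ * ((θ / c) ^ (1 / (1 - α))) ^ α, fun r hr => ?_⟩
  rcases le_total r ((θ / c) ^ (1 / (1 - α))) with h | h
  · have : r ^ α ≤ ((θ / c) ^ (1 / (1 - α))) ^ α := Real.rpow_le_rpow hr.le h hα0.le
    nlinarith [mul_pos hc hr]
  · have h2 : θ / c ≤ r ^ (1 - α) := by
      calc θ / c = ((θ / c) ^ (1 / (1 - α))) ^ (1 - α) := by
            rw [← Real.rpow_mul (by positivity), one_div_mul_cancel h1.ne', Real.rpow_one]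
        _ ≤ _ := Real.rpow_le_rpow (by positivity) h h1.le
    have h3 : r = r ^ (1 - α) * r ^ α := by
      rw [← Real.rpow_add hr]; simp
    have h4 : θ * r ^ α ≤ c * r := by
      rw [div_le_iff₀ hc] at h2
      calc θ * r ^ α ≤ (r ^ (1 - α) * c) * r ^ α := by gcongr
        _ = c * (r ^ (1 - α) * r ^ α) := by ring
        _ = c * r := by rw [← h3]
    have : 0 ≤ θ * ((θ / c) ^ (1 / (1 - α))) ^ α := by positivity
    linarith

/-- The Wright series is the imaginary part of an integral over a ray. Reflection turns the
coefficient `1 / Γ(1 - a)`, `a = 1 - β + α n`, into `Γ(a) sin (π a) / π`; here `Γ(a) e ^ (i π a)` is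
`e ^ (i ψ a) ∫ r ^ (a - 1) e ^ (-ζ r) dr`, and the sum over `n` under the integral is
exponential. -/
lemma hasSum_wrightGen {α β ψ θ : ℝ} (hα0 : 0 < α) (hα : α < 1) (hβ : β < 1)
    (hψ : ψ ∈ Ioo (Real.pi / 2) Real.pi) (hθ : 0 < θ) :
    HasSum (fun n : ℕ => (-θ) ^ n / ((n.factorial : ℝ) * Real.Gamma (β - α * n)))
      (Real.pi⁻¹ * (Complex.exp ((ψ * (1 - β) : ℝ) * Complex.I) *
        ∫ r in Ioi (0 : ℝ), wrightKernel α β ψ θ r).im) := by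
  have hφ : ψ - Real.pi ∈ Ioo (-(Real.pi / 2)) (Real.pi / 2) :=
    ⟨by linarith [hψ.1], by linarith [hψ.2, Real.pi_pos]⟩
  set ζ : ℂ := Complex.exp ((ψ - Real.pi : ℝ) * Complex.I) with hζ
  set w : ℂ := Complex.exp ((α * ψ : ℝ) * Complex.I) with hw
  have hnw : ‖w‖ = 1 := Complex.norm_exp_ofReal_mul_I _
  have hre : 0 < ζ.re := by
    rw [hζ, Complex.exp_ofReal_mul_I_re]; exact Real.cos_pos_of_mem_Ioo hφ
  obtain ⟨K, hK⟩ := exists_mul_rpow_le hα0 hα hθ (half_pos hre)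
  have ha : ∀ n : ℕ, 0 < 1 - (β - α * n) := fun n => by
    have : 0 ≤ α * n := by positivity
    linarith
  let F : ℕ → ℝ → ℂ := fun n r =>
    ((r ^ ((1 - (β - α * n)) - 1) : ℝ) : ℂ) * Complex.exp (-(ζ * r)) *
      ((-θ * w) ^ n / (n.factorial : ℂ))
  have hFeq : ∀ n : ℕ, ∀ r ∈ Ioi (0 : ℝ), F n r = ((r ^ (-β) : ℝ) : ℂ) * Complex.exp (-(ζ * r)) *
      ((-((θ * r ^ α : ℝ) * w)) ^ n / (n.factorial : ℂ)) := by
    intro n r hr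
    have hr' : 0 < r := hr
    have : r ^ ((1 - (β - α * n)) - 1) = r ^ (-β) * (r ^ α) ^ n := by
      rw [← Real.rpow_natCast, ← Real.rpow_mul hr'.le, ← Real.rpow_add hr']
      congr 1; ring
    simp only [F]
    rw [this]
    push_cast
    rw [show -((θ : ℂ) * ((r ^ α : ℝ) : ℂ) * w) = (-θ * w) * ((r ^ α : ℝ) : ℂ) by ring,
      mul_pow _ ((r ^ α : ℝ) : ℂ)]
    ring
  have hnorm : ∀ n : ℕ, ∀ r ∈ Ioi (0 : ℝ), ‖F n r‖ =
      r ^ (-β) * Real.exp (-ζ.re * r) * ((θ * r ^ α) ^ n / (n.factorial : ℝ)) := by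
    intro n r hr
    have hr' : 0 < r := hr
    rw [hFeq n r hr, norm_mul, show -β = (1 - β) - 1 by ring, norm_rpow_mul_cexp_neg_mul _ _ hr,
      norm_div, norm_pow, norm_neg, norm_mul, hnw, mul_one, Complex.norm_real,
      Real.norm_of_nonneg (by positivity), Complex.norm_natCast]
  -- the sum of the norms is `r ^ (-β) exp (-(re ζ) r + θ r ^ α)`, integrable because `α < 1`
  have key : HasSum (fun n => ∫ r in Ioi (0 : ℝ), F n r)
      (∫ r in Ioi (0 : ℝ), wrightKernel α β ψ θ r) := by
    refine hasSum_integral_of_dominated_convergence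
      (fun n r => r ^ (-β) * Real.exp (-ζ.re * r) * ((θ * r ^ α) ^ n / (n.factorial : ℝ)))
      ?_ ?_ ?_ ?_ ?_
    · intro n
      exact (aestronglyMeasurable_rpow_mul_cexp_neg_mul _ _).mul_const _
    · intro n
      filter_upwards [ae_restrict_mem measurableSet_Ioi] with r hr
      exact (hnorm n r hr).le
    · refine Eventually.of_forall fun r => ?_
      exact (Real.summable_pow_div_factorial _).mul_left _
    · have hsum : ∀ r : ℝ, ∑' n : ℕ, r ^ (-β) * Real.exp (-ζ.re * r) *
          ((θ * r ^ α) ^ n / (n.factorial : ℝ)) =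
          r ^ (-β) * Real.exp (-ζ.re * r) * Real.exp (θ * r ^ α) := by
        intro r
        rw [tsum_mul_left, Real.exp_eq_exp_ℝ, NormedSpace.exp_eq_tsum_div]
      simp_rw [hsum]
      refine Integrable.mono'
        ((integrableOn_rpow_mul_exp_neg_mul (a := 1 - β) (by linarith) (half_pos hre)).const_mul
          (Real.exp K)) (Measurable.aestronglyMeasurable (by fun_prop)) ?_
      filter_upwards [ae_restrict_mem measurableSet_Ioi] with r hr
      have hr' : 0 < r := hr
      rw [Real.norm_of_nonneg (by positivity), show 1 - β - 1 = -β by ring, mul_assoc,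
        ← Real.exp_add, mul_left_comm, ← Real.exp_add]
      refine mul_le_mul_of_nonneg_left (Real.exp_le_exp.2 ?_) (by positivity)
      linarith [hK r hr']
    · filter_upwards [ae_restrict_mem measurableSet_Ioi] with r hr
      have h := (NormedSpace.expSeries_div_hasSum_exp (-((θ * r ^ α : ℝ) * w))).mul_left
        (((r ^ (-β) : ℝ) : ℂ) * Complex.exp (-(ζ * r)))
      rw [← Complex.exp_eq_exp_ℂ] at h
      exact h.congr_fun fun n => hFeq n r hr
  have h2 := Complex.imCLM.hasSum (key.mul_left (Complex.exp ((ψ * (1 - β) : ℝ) * Complex.I)))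
  refine (h2.mul_left Real.pi⁻¹).congr_fun fun n => ?_
  have hpolar := integral_rpow_mul_cexp_neg_polar_Ioi (ha n) one_pos hφ
  rw [Complex.ofReal_one, one_mul, Real.one_rpow, mul_one, ← hζ] at hpolar
  have hphase : Complex.exp ((ψ * (1 - β) : ℝ) * Complex.I) * ∫ r in Ioi (0 : ℝ), F n r =
      (((-θ) ^ n / (n.factorial : ℝ) * Real.Gamma (1 - (β - α * n)) : ℝ) : ℂ) *
        Complex.exp ((Real.pi * (1 - (β - α * n)) : ℝ) * Complex.I) := by
    have hexp : Complex.exp ((Real.pi * (1 - (β - α * n)) : ℝ) * Complex.I) =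
        Complex.exp ((ψ * (1 - β) : ℝ) * Complex.I) *
          Complex.exp (-((1 - (β - α * n) : ℝ) * (ψ - Real.pi : ℝ)) * Complex.I) * w ^ n := by
      rw [hw, ← Complex.exp_nat_mul, ← Complex.exp_add, ← Complex.exp_add]
      congr 1
      push_cast
      ring
    simp only [F]
    rw [integral_mul_const, hpolar, hexp]
    push_cast
    ring
  change _ = Real.pi⁻¹ * (_ : ℂ).im
  rw [hphase, Complex.im_ofReal_mul, Complex.exp_ofReal_mul_I_im, div_mul_eq_div_div,
    div_eq_mul_inv,
    inv_Gamma_eq (by linarith [ha n])]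
  ring

lemma wrightGen_eq_integral {α β ψ θ : ℝ} (hα0 : 0 < α) (hα : α < 1) (hβ : β < 1)
    (hψ : ψ ∈ Ioo (Real.pi / 2) Real.pi) (hθ : 0 < θ) :
    wrightGen α β θ = Real.pi⁻¹ * (Complex.exp ((ψ * (1 - β) : ℝ) * Complex.I) *
        ∫ r in Ioi (0 : ℝ), wrightKernel α β ψ θ r).im :=
  (hasSum_wrightGen hα0 hα hβ hψ hθ).tsum_eq

lemma rpow_mul_wrightKernel_eq {α β ψ s θ r : ℝ} :
    ((θ ^ (s - 1) : ℝ) : ℂ) * wrightKernel α β ψ θ r =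
      ((r ^ (-β) : ℝ) : ℂ) * Complex.exp (-(Complex.exp ((ψ - Real.pi : ℝ) * Complex.I) * r)) *
      (((θ ^ (s - 1) : ℝ) : ℂ) * Complex.exp (-((((r ^ α : ℝ) : ℂ) *
        Complex.exp ((α * ψ : ℝ) * Complex.I)) * θ))) := by
  rw [wrightKernel]
  push_cast
  rw [show (θ : ℂ) * ((r ^ α : ℝ) : ℂ) * Complex.exp (α * ψ * Complex.I) =
    ((r ^ α : ℝ) : ℂ) * Complex.exp (α * ψ * Complex.I) * θ by ring]
  ring

/-- The kernel of the Mellin transform of the Wright function is absolutely integrable: integrating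
first in `θ` leaves a multiple of `r ^ (-β - α s) e ^ (-c r)`. -/
lemma integrable_rpow_mul_wrightKernel {α β ψ s : ℝ} (hα0 : 0 < α) (hs : 0 < s)
    (hβs : β + α * s < 1) (hψ : ψ ∈ Ioo (Real.pi / 2) Real.pi) (hαψ : α * ψ < Real.pi / 2) :
    Integrable (Function.uncurry fun θ r : ℝ => ((θ ^ (s - 1) : ℝ) : ℂ) * wrightKernel α β ψ θ r)
      ((volume.restrict (Ioi (0 : ℝ))).prod (volume.restrict (Ioi (0 : ℝ)))) := by
  have hπ := Real.pi_pos
  have hφ : ψ - Real.pi ∈ Ioo (-(Real.pi / 2)) (Real.pi / 2) :=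
    ⟨by linarith [hψ.1], by linarith [hψ.2]⟩
  have hφ' : α * ψ ∈ Ioo (-(Real.pi / 2)) (Real.pi / 2) :=
    ⟨by nlinarith [mul_pos hα0 (show 0 < ψ by linarith [hψ.1])], hαψ⟩
  have hre : 0 < (Complex.exp ((ψ - Real.pi : ℝ) * Complex.I)).re := by
    rw [Complex.exp_ofReal_mul_I_re]; exact Real.cos_pos_of_mem_Ioo hφ
  have hre' : ∀ r ∈ Ioi (0 : ℝ),
      0 < (((r ^ α : ℝ) : ℂ) * Complex.exp ((α * ψ : ℝ) * Complex.I)).re := by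
    intro r hr
    rw [Complex.re_ofReal_mul, Complex.exp_ofReal_mul_I_re]
    exact mul_pos (Real.rpow_pos_of_pos hr _) (Real.cos_pos_of_mem_Ioo hφ')
  have hc := Real.cos_pos_of_mem_Ioo hφ'
  rw [integrable_prod_iff']
  · constructor
    · filter_upwards [ae_restrict_mem measurableSet_Ioi] with r hr
      simp only [Function.uncurry_apply_pair, rpow_mul_wrightKernel_eq]
      exact (integrableOn_rpow_mul_cexp_neg_mul hs (hre' r hr)).const_mul _
    · refine ((integrableOn_rpow_mul_exp_neg_mul (a := 1 - (β + α * s)) (by linarith) hre).const_mul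
        (Real.Gamma s * Real.cos (α * ψ) ^ (-s))).congr ?_
      filter_upwards [ae_restrict_mem measurableSet_Ioi] with r hr
      have hr' : 0 < r := hr
      simp only [Function.uncurry_apply_pair, rpow_mul_wrightKernel_eq]
      have h1 : ∀ θ ∈ Ioi (0 : ℝ),
          ‖((r ^ (-β) : ℝ) : ℂ) * Complex.exp (-(Complex.exp ((ψ - Real.pi : ℝ) * Complex.I) * r)) *
          (((θ ^ (s - 1) : ℝ) : ℂ) * Complex.exp (-((((r ^ α : ℝ) : ℂ) *
            Complex.exp ((α * ψ : ℝ) * Complex.I)) * θ)))‖ =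
          (r ^ (-β) * Real.exp (-(Complex.exp ((ψ - Real.pi : ℝ) * Complex.I)).re * r)) *
            (θ ^ (s - 1) * Real.exp (-((r ^ α * Real.cos (α * ψ)) * θ))) := by
        intro θ hθ
        rw [norm_mul, norm_rpow_mul_cexp_neg_mul _ _ hθ, show -β = (1 - β) - 1 by ring,
          norm_rpow_mul_cexp_neg_mul _ _ hr, Complex.re_ofReal_mul,
            Complex.exp_ofReal_mul_I_re (α * ψ),
          neg_mul (r ^ α * Real.cos (α * ψ))]
      rw [setIntegral_congr_fun measurableSet_Ioi h1, integral_const_mul,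
        Real.integral_rpow_mul_exp_neg_mul_Ioi hs (by positivity), one_div,
          ← Real.rpow_neg_eq_inv_rpow,
        Real.mul_rpow (by positivity) hc.le, ← Real.rpow_mul hr'.le,
        show 1 - (β + α * s) - 1 = -β + α * (-s) by ring, Real.rpow_add hr']
      ring
  · apply Measurable.aestronglyMeasurable
    unfold wrightKernel Function.uncurry
    fun_prop

/-- The Mellin transform of the Wright function, by Fubini on the Hankel integral; the phases
recombine to `sin (π (1 - β - α s))`, which the reflection formula absorbs. -/
lemma mellin_wrightGen {α β s : ℝ} (hα0 : 0 < α) (hα : α < 1) (hs : 0 < s)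
    (hβs : β + α * s < 1) :
    IntegrableOn (fun θ : ℝ => θ ^ (s - 1) * wrightGen α β θ) (Ioi 0) ∧
    ∫ θ in Ioi (0 : ℝ), θ ^ (s - 1) * wrightGen α β θ =
      Real.Gamma s * (Real.Gamma (β + α * s))⁻¹ := by
  have hπ := Real.pi_pos
  have hα1 : 0 < 1 + α := by linarith
  -- this angle gives decay both in `r` and in `θ`, because `α < 1`
  obtain ⟨ψ, hψ, hαψ⟩ : ∃ ψ : ℝ, ψ ∈ Ioo (Real.pi / 2) Real.pi ∧ α * ψ < Real.pi / 2 := by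
    refine ⟨Real.pi / (1 + α), ⟨?_, ?_⟩, ?_⟩
    · exact div_lt_div_of_pos_left hπ hα1 (by linarith)
    · exact div_lt_self hπ (by linarith)
    · rw [mul_div_assoc', div_lt_div_iff₀ hα1 two_pos]
      nlinarith
  have hβ : β < 1 := by nlinarith [mul_pos hα0 hs]
  have hφ : ψ - Real.pi ∈ Ioo (-(Real.pi / 2)) (Real.pi / 2) :=
    ⟨by linarith [hψ.1], by linarith [hψ.2]⟩
  have hφ' : α * ψ ∈ Ioo (-(Real.pi / 2)) (Real.pi / 2) :=
    ⟨by nlinarith [mul_pos hα0 (show 0 < ψ by linarith [hψ.1])], hαψ⟩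
  have hint := integrable_rpow_mul_wrightKernel hα0 hs hβs hψ hαψ
  set q : ℂ := Complex.exp ((ψ * (1 - β) : ℝ) * Complex.I) with hq
  have hI : Integrable (fun θ : ℝ => q * ∫ r in Ioi (0 : ℝ),
      ((θ ^ (s - 1) : ℝ) : ℂ) * wrightKernel α β ψ θ r) (volume.restrict (Ioi (0 : ℝ))) :=
    hint.integral_prod_left.const_mul q
  have heq : ∀ θ ∈ Ioi (0 : ℝ), θ ^ (s - 1) * wrightGen α β θ = Real.pi⁻¹ *
      (q * ∫ r in Ioi (0 : ℝ), ((θ ^ (s - 1) : ℝ) : ℂ) * wrightKernel α β ψ θ r).im := by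
    intro θ hθ
    rw [wrightGen_eq_integral hα0 hα hβ hψ hθ, integral_const_mul, mul_left_comm q,
      Complex.im_ofReal_mul, ← hq]
    ring
  refine ⟨IntegrableOn.congr_fun (hI.im.const_mul Real.pi⁻¹) (fun θ hθ => (heq θ hθ).symm)
    measurableSet_Ioi, ?_⟩
  rw [setIntegral_congr_fun measurableSet_Ioi heq, integral_const_mul]
  have him := Complex.imCLM.integral_comp_comm hI
  simp only [Complex.imCLM_apply] at him
  rw [him, integral_const_mul, integral_integral_swap hint]
  have hpol := integral_rpow_mul_cexp_neg_polar_Ioi (a := 1 - (β + α * s)) (by linarith) one_pos hφ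
  rw [Complex.ofReal_one, one_mul, Real.one_rpow, mul_one] at hpol
  have hinner : ∀ r ∈ Ioi (0 : ℝ),
      ∫ θ in Ioi (0 : ℝ), ((θ ^ (s - 1) : ℝ) : ℂ) * wrightKernel α β ψ θ r =
      (Real.Gamma s * Complex.exp (-(s * (α * ψ : ℝ)) * Complex.I)) *
      (((r ^ ((1 - (β + α * s)) - 1) : ℝ) : ℂ) *
        Complex.exp (-(Complex.exp ((ψ - Real.pi : ℝ) * Complex.I) * r))) := by
    intro r hr
    have hr' : 0 < r := hr
    simp only [rpow_mul_wrightKernel_eq]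
    rw [integral_const_mul, integral_rpow_mul_cexp_neg_polar_Ioi hs (Real.rpow_pos_of_pos hr' α)
      hφ',
      ← Real.rpow_mul hr'.le, show 1 - (β + α * s) - 1 = -β + α * (-s) by ring, Real.rpow_add hr']
    push_cast
    ring
  rw [setIntegral_congr_fun measurableSet_Ioi hinner, integral_const_mul, hpol]
  have hphase : q * ((Real.Gamma s * Complex.exp (-(s * (α * ψ : ℝ)) * Complex.I)) *
      (Real.Gamma (1 - (β + α * s)) *
        Complex.exp (-((1 - (β + α * s) : ℝ) * (ψ - Real.pi : ℝ)) * Complex.I))) =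
      ((Real.Gamma s * Real.Gamma (1 - (β + α * s)) : ℝ) : ℂ) *
        Complex.exp ((Real.pi * (1 - (β + α * s)) : ℝ) * Complex.I) := by
    have : Complex.exp ((Real.pi * (1 - (β + α * s)) : ℝ) * Complex.I) =
        q * Complex.exp (-(s * (α * ψ : ℝ)) * Complex.I) *
          Complex.exp (-((1 - (β + α * s) : ℝ) * (ψ - Real.pi : ℝ)) * Complex.I) := by
      rw [hq, ← Complex.exp_add, ← Complex.exp_add]
      congr 1
      push_cast
      ring
    rw [this]
    push_cast
    ring
  rw [hphase, Complex.im_ofReal_mul, Complex.exp_ofReal_mul_I_im, inv_Gamma_eq hβs]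
  ring

/-- `α θ Ψ_α(θ)` is the Wright function with `β = 0`. -/
lemma mul_wright_eq {α θ : ℝ} (hα0 : 0 < α) (hα : α < 1) (hθ : 0 < θ) :
    α * θ * wright α θ = wrightGen α 0 θ := by
  have hψ : Real.pi / (1 + α) ∈ Ioo (Real.pi / 2) Real.pi :=
    ⟨div_lt_div_of_pos_left Real.pi_pos (by linarith) (by linarith),
      div_lt_self Real.pi_pos (by linarith)⟩
  have hsum := (hasSum_wrightGen hα0 hα zero_lt_one hψ hθ).summable
  rw [wright_eq_wrightGen, wrightGen, wrightGen, hsum.tsum_eq_zero_add, ← tsum_mul_left]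
  -- the constant term vanishes because `Γ` has a pole at `0`
  have h0 : (-θ) ^ 0 / (((0 : ℕ).factorial : ℝ) * Real.Gamma (0 - α * (0 : ℕ))) = 0 := by
    simp [Real.Gamma_zero]
  rw [h0, zero_add]
  refine tsum_congr fun n => ?_
  have hne : 0 - α * ((n + 1 : ℕ) : ℝ) ≠ 0 := by
    have : 0 < α * ((n + 1 : ℕ) : ℝ) := by positivity
    linarith
  have hG := Real.Gamma_add_one hne
  rw [show 1 - α - α * (n : ℝ) = 0 - α * ((n + 1 : ℕ) : ℝ) + 1 by push_cast; ring, hG,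
    Nat.factorial_succ, pow_succ]
  push_cast at hne ⊢
  have hn : (n : ℝ) + 1 ≠ 0 := by positivity
  have hf : (n.factorial : ℝ) ≠ 0 := by positivity
  by_cases hΓ : Real.Gamma (0 - α * ((n : ℝ) + 1)) = 0
  · rw [hΓ]; simp
  · have := hα0.ne'
    field_simp
    ring

lemma integrableOn_mul_wright {α : ℝ} (hα0 : 0 < α) (hα : α < 1) :
    IntegrableOn (fun θ : ℝ => α * θ * wright α θ) (Ioi 0) := by
  refine (mellin_wrightGen (β := 0) hα0 hα one_pos (by linarith)).1.congr_fun
    (fun θ hθ => ?_) measurableSet_Ioi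
  simp [mul_wright_eq hα0 hα hθ]

lemma integral_mul_wright {α : ℝ} (hα0 : 0 < α) (hα : α < 1) :
    ∫ θ in Ioi (0 : ℝ), α * θ * wright α θ = (Real.Gamma α)⁻¹ := by
  have h := (mellin_wrightGen (β := 0) hα0 hα one_pos (by linarith)).2
  simp only [sub_self, Real.rpow_zero, one_mul, Real.Gamma_one, zero_add, mul_one] at h
  rw [← h]
  exact setIntegral_congr_fun measurableSet_Ioi fun θ hθ => mul_wright_eq hα0 hα hθ

/-- For `s ∈ [1/2, 1]`, the function `θ ^ (s - 1) |Ψ_α(θ)|` is dominated by this sum, whose two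
terms handle `θ → 0` and `θ → ∞`. -/
lemma rpow_mul_abs_wright_le {α s θ : ℝ} (hα0 : 0 < α) (hs : 1 / 2 ≤ s) (hs1 : s ≤ 1) (hθ : 0 < θ) :
    θ ^ (s - 1) * |wright α θ| ≤
      |θ ^ ((1 / 2 : ℝ) - 1) * wright α θ| + α⁻¹ * |α * θ * wright α θ| := by
  rw [abs_mul, abs_mul, abs_of_pos (Real.rpow_pos_of_pos hθ _), abs_of_pos (mul_pos hα0 hθ)]
  have h2 : α⁻¹ * (α * θ * |wright α θ|) = θ * |wright α θ| := by field_simp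
  rw [h2, ← add_mul]
  refine mul_le_mul_of_nonneg_right ?_ (abs_nonneg _)
  have hp := Real.rpow_pos_of_pos hθ ((1 / 2 : ℝ) - 1)
  rcases le_total θ 1 with h | h
  · have := Real.rpow_le_rpow_of_exponent_ge hθ h (show (1 / 2 : ℝ) - 1 ≤ s - 1 by linarith)
    linarith
  · have := Real.rpow_le_one_of_one_le_of_nonpos h (show s - 1 ≤ 0 by linarith)
    linarith

lemma aestronglyMeasurable_wright {α : ℝ} (hα0 : 0 < α) (hα : α < 1) :
    AEStronglyMeasurable (wright α) (volume.restrict (Ioi (0 : ℝ))) := by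
  have h := (integrableOn_mul_wright hα0 hα).aestronglyMeasurable
  have hm : AEStronglyMeasurable (fun θ : ℝ => (α * θ)⁻¹) (volume.restrict (Ioi (0 : ℝ))) :=
    Measurable.aestronglyMeasurable (by fun_prop)
  refine (hm.mul h).congr ?_
  filter_upwards [ae_restrict_mem measurableSet_Ioi] with θ hθ
  have hθ' : 0 < θ := hθ
  have := hα0.ne'
  change (α * θ)⁻¹ * (α * θ * wright α θ) = _
  field_simp

lemma integrableOn_wright_bound {α : ℝ} (hα0 : 0 < α) (hα : α < 1) :
    IntegrableOn (fun θ : ℝ => |θ ^ ((1 / 2 : ℝ) - 1) * wright α θ| + α⁻¹ * |α * θ * wright α θ|)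
      (Ioi 0) := by
  have h := (mellin_wrightGen (β := 1 - α) (s := 1 / 2) hα0 hα (by norm_num) (by linarith)).1
  simp only [← wright_eq_wrightGen] at h
  exact h.abs.add ((integrableOn_mul_wright hα0 hα).abs.const_mul _)

lemma integrableOn_wright {α : ℝ} (hα0 : 0 < α) (hα : α < 1) :
    IntegrableOn (wright α) (Ioi 0) := by
  refine (integrableOn_wright_bound hα0 hα).mono' (aestronglyMeasurable_wright hα0 hα) ?_
  filter_upwards [ae_restrict_mem measurableSet_Ioi] with θ hθ
  simpa using rpow_mul_abs_wright_le hα0 (s := 1) (by norm_num) le_rfl hθ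

/-- `Ψ_α` has total mass one: its Mellin transform at `s` is `Γ(s) / Γ(1 - α + α s)`, and
`s → 1`. -/
lemma integral_wright {α : ℝ} (hα0 : 0 < α) (hα : α < 1) :
    ∫ θ in Ioi (0 : ℝ), wright α θ = 1 := by
  have h1 : Tendsto (fun s : ℝ => ∫ θ in Ioi (0 : ℝ), θ ^ (s - 1) * wright α θ) (𝓝[<] 1)
      (𝓝 (∫ θ in Ioi (0 : ℝ), wright α θ)) := by
    refine tendsto_integral_filter_of_dominated_convergence _
      (Eventually.of_forall fun s => ?_) ?_ (integrableOn_wright_bound hα0 hα) ?_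
    · exact (Measurable.aestronglyMeasurable (by fun_prop)).mul (aestronglyMeasurable_wright hα0 hα)
    · have : Ioo (1 / 2 : ℝ) 1 ∈ 𝓝[<] (1 : ℝ) := Ioo_mem_nhdsLT (by norm_num)
      filter_upwards [this] with s hs
      filter_upwards [ae_restrict_mem measurableSet_Ioi] with θ hθ
      rw [norm_mul, Real.norm_of_nonneg (Real.rpow_pos_of_pos hθ _).le, Real.norm_eq_abs]
      exact rpow_mul_abs_wright_le hα0 hs.1.le hs.2.le hθ
    · filter_upwards [ae_restrict_mem measurableSet_Ioi] with θ hθ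
      have hθ' : θ ≠ 0 := ne_of_gt hθ
      have hc : ContinuousAt (fun s : ℝ => θ ^ (s - 1) * wright α θ) 1 := by
        have := Real.continuousAt_const_rpow (b := (1 : ℝ) - 1) hθ'
        exact (ContinuousAt.comp (f := fun s : ℝ => s - 1) this (by fun_prop)).mul
          continuousAt_const
      have := hc.tendsto.mono_left (nhdsWithin_le_nhds (s := Iio 1))
      simpa using this
  have hΓ : ContinuousAt Real.Gamma 1 :=
    (Real.differentiableAt_Gamma fun m => by
      have : (0 : ℝ) ≤ m := m.cast_nonneg
      linarith).continuousAt
  have h2 : Tendsto (fun s : ℝ => ∫ θ in Ioi (0 : ℝ), θ ^ (s - 1) * wright α θ) (𝓝[<] 1) (𝓝 1) := by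
    have hlim : ContinuousAt
        (fun s : ℝ => Real.Gamma s * (Real.Gamma (1 - α + α * s))⁻¹) 1 := by
      refine hΓ.mul (ContinuousAt.inv₀ ?_ ?_)
      · exact ContinuousAt.comp (f := fun s : ℝ => 1 - α + α * s)
          (by rw [show 1 - α + α * 1 = 1 by ring]; exact hΓ) (by fun_prop)
      · rw [show 1 - α + α * 1 = 1 by ring, Real.Gamma_one]; exact one_ne_zero
    have := hlim.tendsto.mono_left (nhdsWithin_le_nhds (s := Iio 1))
    rw [show 1 - α + α * 1 = 1 by ring, Real.Gamma_one, inv_one, mul_one] at this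
    refine this.congr' ?_
    have : Ioo (0 : ℝ) 1 ∈ 𝓝[<] (1 : ℝ) := Ioo_mem_nhdsLT (by norm_num)
    filter_upwards [this] with s hs
    simp only [wright_eq_wrightGen]
    exact (mellin_wrightGen hα0 hα hs.1 (by nlinarith [hs.2])).2.symm
  exact tendsto_nhds_unique h1 h2

/-! ### The sine basis of `L²[0, π]` -/

lemma coeFn_contL2 (f : ℝ → ℝ) (hf : Continuous f) :
    (contL2 f hf : ℝ → ℝ) =ᵐ[volume.restrict (Icc (0 : ℝ) Real.pi)] f :=
  MemLp.coeFn_toLp _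

lemma inner_contL2 (f : ℝ → ℝ) (hf : Continuous f) (y : L2Pi) :
    inner ℝ (contL2 f hf) y = ∫ s in (0 : ℝ)..Real.pi, f s * y s := by
  rw [L2.inner_def, intervalIntegral.integral_of_le Real.pi_pos.le, ← integral_Icc_eq_integral_Ioc]
  refine integral_congr_ae ?_
  filter_upwards [coeFn_contL2 f hf] with s hs
  rw [hs]
  simp [mul_comm]

lemma inner_sineMode (n : ℕ) (y : L2Pi) :
    inner ℝ (sineMode n) y =
      Real.sqrt (2 / Real.pi) * ∫ s in (0 : ℝ)..Real.pi, Real.sin (((n : ℝ) + 1) * s) * y s := by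
  rw [sineMode, inner_contL2, ← intervalIntegral.integral_const_mul]
  simp only [mul_assoc]

lemma intervalIntegrable_L2Pi (y : L2Pi) : IntervalIntegrable y volume 0 Real.pi := by
  rw [intervalIntegrable_iff_integrableOn_Icc_of_le Real.pi_pos.le]
  exact (Lp.memLp y).integrable (by norm_num)

lemma integral_cos_int_mul {k : ℤ} (hk : k ≠ 0) :
    ∫ s in (0 : ℝ)..Real.pi, Real.cos ((k : ℝ) * s) = 0 := by
  have hk' : (k : ℝ) ≠ 0 := by exact_mod_cast hk
  rw [intervalIntegral.integral_comp_mul_left (fun s => Real.cos s) hk', integral_cos,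
    Real.sin_int_mul_pi]
  simp

lemma integral_sin_mul_sin_nat (m n : ℕ) :
    ∫ s in (0 : ℝ)..Real.pi, Real.sin (((m : ℝ) + 1) * s) * Real.sin (((n : ℝ) + 1) * s) =
      if m = n then Real.pi / 2 else 0 := by
  have h : ∀ s : ℝ, Real.sin (((m : ℝ) + 1) * s) * Real.sin (((n : ℝ) + 1) * s) =
      2⁻¹ * (Real.cos ((((m : ℤ) - n : ℤ) : ℝ) * s) -
        Real.cos ((((m : ℤ) + n + 2 : ℤ) : ℝ) * s)) := by
    intro s
    have h1 : (((m : ℤ) - n : ℤ) : ℝ) * s = ((m : ℝ) + 1) * s - ((n : ℝ) + 1) * s := by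
      push_cast; ring
    have h2 : (((m : ℤ) + n + 2 : ℤ) : ℝ) * s = ((m : ℝ) + 1) * s + ((n : ℝ) + 1) * s := by
      push_cast; ring
    rw [h1, h2, Real.cos_sub, Real.cos_add]
    ring
  simp_rw [h]
  rw [intervalIntegral.integral_const_mul, intervalIntegral.integral_sub
    (Continuous.intervalIntegrable (by fun_prop) _ _)
    (Continuous.intervalIntegrable (by fun_prop) _ _),
    integral_cos_int_mul (k := (m : ℤ) + n + 2) (by omega)]
  split_ifs with hmn
  · subst hmn
    simp
    ring
  · rw [integral_cos_int_mul (k := (m : ℤ) - n) (by omega)]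
    simp

lemma orthonormal_sineMode : Orthonormal ℝ sineMode := by
  rw [orthonormal_iff_ite]
  intro m n
  have hae := coeFn_contL2 (fun s => Real.sqrt (2 / Real.pi) * Real.sin (((n : ℝ) + 1) * s))
    (by fun_prop)
  have h : ∫ s in (0 : ℝ)..Real.pi, Real.sin (((m : ℝ) + 1) * s) * sineMode n s =
      ∫ s in (0 : ℝ)..Real.pi, Real.sqrt (2 / Real.pi) *
        (Real.sin (((m : ℝ) + 1) * s) * Real.sin (((n : ℝ) + 1) * s)) := by
    rw [intervalIntegral.integral_of_le Real.pi_pos.le,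
      intervalIntegral.integral_of_le Real.pi_pos.le,
      ← integral_Icc_eq_integral_Ioc, ← integral_Icc_eq_integral_Ioc]
    refine integral_congr_ae ?_
    filter_upwards [hae] with s hs
    rw [sineMode, hs]
    ring
  rw [inner_sineMode, h, intervalIntegral.integral_const_mul, integral_sin_mul_sin_nat, ← mul_assoc,
    Real.mul_self_sqrt (by positivity)]
  split_ifs
  · have := Real.pi_ne_zero
    field_simp
  · simp

/-- A function orthogonal to all `sin (m s)` is orthogonal to all `sin (m s) cos (s) ^ k`, because
`2 cos s sin (m s) = sin ((m + 1) s) + sin ((m - 1) s)`. -/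
lemma integral_sin_mul_cos_pow_eq_zero {y : ℝ → ℝ} (hy : IntervalIntegrable y volume 0 Real.pi)
    (h : ∀ n : ℕ, ∫ s in (0 : ℝ)..Real.pi, Real.sin (((n : ℝ) + 1) * s) * y s = 0) (k : ℕ) :
    ∀ m : ℕ, ∫ s in (0 : ℝ)..Real.pi, Real.sin ((m : ℝ) * s) * Real.cos s ^ k * y s = 0 := by
  induction k with
  | zero =>
    intro m
    rcases m with _ | m
    · simp
    · simpa using h m
  | succ k ih =>
    intro m
    rcases m with _ | m
    · simp
    have hI : ∀ j : ℕ, IntervalIntegrable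
        (fun s => Real.sin ((j : ℝ) * s) * Real.cos s ^ k * y s) volume 0 Real.pi := fun j =>
      hy.continuousOn_mul (Continuous.continuousOn (by fun_prop))
    have hs : ∀ s : ℝ, Real.sin (((m + 1 : ℕ) : ℝ) * s) * Real.cos s ^ (k + 1) * y s =
        2⁻¹ * (Real.sin (((m + 2 : ℕ) : ℝ) * s) * Real.cos s ^ k * y s +
          Real.sin ((m : ℝ) * s) * Real.cos s ^ k * y s) := by
      intro s
      have h1 : ((m + 2 : ℕ) : ℝ) * s = ((m + 1 : ℕ) : ℝ) * s + s := by push_cast; ring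
      have h2 : (m : ℝ) * s = ((m + 1 : ℕ) : ℝ) * s - s := by push_cast; ring
      rw [h1, h2, Real.sin_add, Real.sin_sub, pow_succ]
      ring
    simp_rw [hs]
    rw [intervalIntegral.integral_const_mul, intervalIntegral.integral_add (hI _) (hI _), ih, ih]
    simp

/-- The sine system is total: substituting `c = cos s` turns the products `sin s cos (s) ^ k` into a
weight times polynomials, and these are dense by Weierstrass. -/
lemma ae_eq_zero_of_integral_sin_eq_zero {y : ℝ → ℝ} (hy : IntervalIntegrable y volume 0 Real.pi)
    (h : ∀ n : ℕ, ∫ s in (0 : ℝ)..Real.pi, Real.sin (((n : ℝ) + 1) * s) * y s = 0) :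
    ∀ᵐ s ∂(volume.restrict (Icc (0 : ℝ) Real.pi)), y s = 0 := by
  have hπ := Real.pi_pos
  set g : ℝ → ℝ := fun s => Real.sin s * y s with hg
  have hgi : IntervalIntegrable g volume 0 Real.pi :=
    hy.continuousOn_mul (Continuous.continuousOn (by fun_prop))
  have hpoly : ∀ p : Polynomial ℝ, ∫ s in (0 : ℝ)..Real.pi, p.eval (Real.cos s) * g s = 0 := by
    intro p
    have hp : ∀ s : ℝ, p.eval (Real.cos s) * g s = ∑ k ∈ Finset.range (p.natDegree + 1),
        p.coeff k * (Real.sin (((1 : ℕ) : ℝ) * s) * Real.cos s ^ k * y s) := by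
      intro s
      rw [Polynomial.eval_eq_sum_range, Finset.sum_mul]
      refine Finset.sum_congr rfl fun k _ => ?_
      rw [hg, Nat.cast_one, one_mul]
      ring
    simp_rw [hp]
    rw [intervalIntegral.integral_finsetSum]
    · refine Finset.sum_eq_zero fun k _ => ?_
      rw [intervalIntegral.integral_const_mul, integral_sin_mul_cos_pow_eq_zero hy h k 1, mul_zero]
    · intro k _
      exact (hy.continuousOn_mul (Continuous.continuousOn (by fun_prop))).const_mul _
  have hcont : ∀ φ : ℝ → ℝ, Continuous φ → ∫ s in (0 : ℝ)..Real.pi, φ s * g s = 0 := by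
    intro φ hφ
    have hφi : IntervalIntegrable (fun s => φ s * g s) volume 0 Real.pi :=
      hgi.continuousOn_mul hφ.continuousOn
    have hbound : ∀ ε : ℝ, 0 < ε → ‖∫ s in (0 : ℝ)..Real.pi, φ s * g s‖ ≤
        ε * ∫ s in (0 : ℝ)..Real.pi, ‖g s‖ := by
      intro ε hε
      obtain ⟨p, hp⟩ := exists_polynomial_near_of_continuousOn (-1) 1 (φ ∘ Real.arccos)
        (hφ.comp Real.continuous_arccos).continuousOn ε hε
      have hpi : IntervalIntegrable (fun s => p.eval (Real.cos s) * g s) volume 0 Real.pi :=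
        hgi.continuousOn_mul (p.continuous.comp Real.continuous_cos).continuousOn
      have : ∫ s in (0 : ℝ)..Real.pi, φ s * g s =
          ∫ s in (0 : ℝ)..Real.pi, (φ s - p.eval (Real.cos s)) * g s := by
        simp_rw [sub_mul]
        rw [intervalIntegral.integral_sub hφi hpi, hpoly, sub_zero]
      rw [this, ← intervalIntegral.integral_const_mul]
      refine intervalIntegral.norm_integral_le_of_norm_le hπ.le ?_ (hgi.norm.const_mul ε)
      refine Eventually.of_forall fun s hs => ?_
      rw [norm_mul]
      refine mul_le_mul_of_nonneg_right ?_ (norm_nonneg _)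
      have := hp (Real.cos s) ⟨Real.neg_one_le_cos s, Real.cos_le_one s⟩
      rw [Function.comp_apply, Real.arccos_cos hs.1.le hs.2, abs_sub_comm] at this
      exact this.le
    have hlim : Tendsto (fun ε : ℝ => ε * ∫ s in (0 : ℝ)..Real.pi, ‖g s‖) (𝓝[>] 0) (𝓝 0) := by
      have : Tendsto (fun ε : ℝ => ε * ∫ s in (0 : ℝ)..Real.pi, ‖g s‖) (𝓝 0)
          (𝓝 (0 * ∫ s in (0 : ℝ)..Real.pi, ‖g s‖)) := tendsto_id.mul_const _
      rw [zero_mul] at this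
      exact this.mono_left nhdsWithin_le_nhds
    have := ge_of_tendsto hlim (eventually_mem_nhdsWithin.mono fun ε hε => hbound ε hε)
    simpa using this
  have hgI : Integrable ((Ioc 0 Real.pi).indicator g) volume :=
    (integrable_indicator_iff measurableSet_Ioc).2
      ((intervalIntegrable_iff_integrableOn_Ioc_of_le hπ.le).1 hgi)
  have hzero := ae_eq_zero_of_integral_contDiff_smul_eq_zero hgI.locallyIntegrable
    (fun φ hφ _ => by
      have h1 : ∀ s, φ s • (Ioc 0 Real.pi).indicator g s =
          (Ioc 0 Real.pi).indicator (fun s => φ s * g s) s := by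
        intro s
        by_cases hs : s ∈ Ioc 0 Real.pi <;> simp [hs]
      simp_rw [h1]
      rw [integral_indicator measurableSet_Ioc, ← intervalIntegral.integral_of_le hπ.le]
      exact hcont φ hφ.continuous)
  have hne : ∀ᵐ s ∂(volume : Measure ℝ), s ≠ 0 ∧ s ≠ Real.pi := by
    have h0 : ∀ᵐ s ∂(volume : Measure ℝ), s ≠ 0 := by simp [ae_iff, measure_singleton]
    have h1 : ∀ᵐ s ∂(volume : Measure ℝ), s ≠ Real.pi := by simp [ae_iff, measure_singleton]
    exact h0.and h1
  rw [ae_restrict_iff' measurableSet_Icc]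
  filter_upwards [hzero, hne] with s hs hs' hmem
  have hs0 : 0 < s := lt_of_le_of_ne hmem.1 hs'.1.symm
  have hs1 : s < Real.pi := lt_of_le_of_ne hmem.2 hs'.2
  rw [indicator_of_mem (show s ∈ Ioc 0 Real.pi from ⟨hs0, hmem.2⟩)] at hs
  exact (mul_eq_zero.1 hs).resolve_left (Real.sin_pos_of_pos_of_lt_pi hs0 hs1).ne'

lemma eq_zero_of_inner_sineMode_eq_zero {y : L2Pi} (h : ∀ n, inner ℝ (sineMode n) y = 0) :
    y = 0 := by
  rw [Lp.eq_zero_iff_ae_eq_zero]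
  refine ae_eq_zero_of_integral_sin_eq_zero (intervalIntegrable_L2Pi y) fun n => ?_
  have := h n
  rw [inner_sineMode] at this
  exact (mul_eq_zero.1 this).resolve_left (Real.sqrt_pos.2 (by positivity)).ne'

/-- The sine modes as a Hilbert basis of `L²[0, π]`. -/
noncomputable def sineBasis : HilbertBasis ℕ ℝ L2Pi :=
  HilbertBasis.mkOfOrthogonalEqBot orthonormal_sineMode (by
    rw [Submodule.eq_bot_iff]
    intro y hy
    exact eq_zero_of_inner_sineMode_eq_zero fun n =>
      (Submodule.mem_orthogonal _ _).1 hy _ (Submodule.subset_span (mem_range_self n)))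

lemma coe_sineBasis : (sineBasis : ℕ → L2Pi) = sineMode :=
  HilbertBasis.coe_mkOfOrthogonalEqBot _ _

/-! ### Operators that are diagonal in the sine basis -/

lemma ext_inner_sineMode {x y : L2Pi}
    (h : ∀ n, inner ℝ (sineMode n) x = inner ℝ (sineMode n) y) : x = y := by
  rw [← sub_eq_zero]
  refine eq_zero_of_inner_sineMode_eq_zero fun n => ?_
  rw [inner_sub_right, h, sub_self]

lemma hasSum_sq_inner_sineMode (x : L2Pi) :
    HasSum (fun n => (inner ℝ (sineMode n) x) ^ 2) (‖x‖ ^ 2) := by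
  have h := sineBasis.hasSum_inner_mul_inner x x
  rw [real_inner_self_eq_norm_sq] at h
  refine h.congr_fun fun n => ?_
  rw [coe_sineBasis, real_inner_comm x, sq]

lemma inner_sineMode_sineMode (m n : ℕ) :
    inner ℝ (sineMode m) (sineMode n) = if m = n then (1 : ℝ) else 0 :=
  orthonormal_iff_ite.1 orthonormal_sineMode m n

/-- The operator with eigenvalue `c n` on `sineMode n`; the series converges when `c` is bounded. -/
noncomputable def diagFun (c : ℕ → ℝ) (x : L2Pi) : L2Pi :=
  ∑' n : ℕ, (c n * inner ℝ (sineMode n) x) • sineMode n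

lemma heatSemigroup_eq_diagFun (t : ℝ) :
    heatSemigroup t = diagFun fun n => Real.exp (-((n : ℝ) + 1) ^ 2 * t) := rfl

open Classical in
lemma windowB_eq_diagFun (t : ℝ) :
    windowB t = diagFun fun n => if 1 - 1 / ((n : ℝ) + 1) ^ 2 ≤ t then 1 else 0 := by
  funext w
  refine tsum_congr fun n => ?_
  by_cases h : 1 - 1 / ((n : ℝ) + 1) ^ 2 ≤ t
  · simp only [if_pos h, one_mul]
  · simp only [if_neg h, zero_mul, zero_smul]

lemma hasSum_diagFun {c : ℕ → ℝ} {C : ℝ} (hc : ∀ n, |c n| ≤ C) (x : L2Pi) :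
    HasSum (fun n => (c n * inner ℝ (sineMode n) x) • sineMode n) (diagFun c x) := by
  have hmem : Memℓp (fun n => c n * inner ℝ (sineMode n) x) 2 := by
    rw [memℓp_gen_iff (by norm_num)]
    refine Summable.of_nonneg_of_le (fun n => by positivity) (fun n => ?_)
      ((hasSum_sq_inner_sineMode x).summable.mul_left (C ^ 2))
    simp only [ENNReal.toReal_ofNat, Real.rpow_ofNat, norm_mul, mul_pow, Real.norm_eq_abs, sq_abs]
    refine mul_le_mul_of_nonneg_right ?_ (sq_nonneg _)
    have := pow_le_pow_left₀ (abs_nonneg _) (hc n) 2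
    rwa [sq_abs] at this
  have h := sineBasis.hasSum_repr_symm ⟨_, hmem⟩
  rw [coe_sineBasis] at h
  exact h.summable.hasSum

lemma inner_diagFun {c : ℕ → ℝ} {C : ℝ} (hc : ∀ n, |c n| ≤ C) (x : L2Pi) (n : ℕ) :
    inner ℝ (sineMode n) (diagFun c x) = c n * inner ℝ (sineMode n) x := by
  have h := (innerSL ℝ (sineMode n)).hasSum (hasSum_diagFun hc x)
  refine h.unique ?_
  have h2 := hasSum_ite_eq n (c n * inner ℝ (sineMode n) x)
  refine h2.congr_fun fun m => ?_
  rw [innerSL_apply_apply, inner_smul_right, inner_sineMode_sineMode]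
  rcases eq_or_ne m n with rfl | hmn
  · simp
  · simp [hmn, hmn.symm]

lemma norm_diagFun_le {c : ℕ → ℝ} {C : ℝ} (hc : ∀ n, |c n| ≤ C) (x : L2Pi) :
    ‖diagFun c x‖ ≤ C * ‖x‖ := by
  have hC : 0 ≤ C := (abs_nonneg _).trans (hc 0)
  refine le_of_sq_le_sq ?_ (by positivity)
  rw [mul_pow]
  refine hasSum_le (fun n => ?_) (hasSum_sq_inner_sineMode (diagFun c x))
    ((hasSum_sq_inner_sineMode x).mul_left (C ^ 2))
  rw [inner_diagFun hc, mul_pow]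
  refine mul_le_mul_of_nonneg_right ?_ (sq_nonneg _)
  have := pow_le_pow_left₀ (abs_nonneg _) (hc n) 2
  rwa [sq_abs] at this

lemma isLinearMap_diagFun {c : ℕ → ℝ} {C : ℝ} (hc : ∀ n, |c n| ≤ C) :
    IsLinearMap ℝ (diagFun c) where
  map_add x y := ext_inner_sineMode fun n => by
    simp only [inner_add_right, inner_diagFun hc]; ring
  map_smul r x := ext_inner_sineMode fun n => by
    simp only [inner_smul_right, inner_diagFun hc]; ring

/-- `diagFun c` for bounded `c`, as a continuous linear map. -/
noncomputable def diagCLM (c : ℕ → ℝ) (hc : ∃ C, ∀ n, |c n| ≤ C) : L2Pi →L[ℝ] L2Pi :=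
  (isLinearMap_diagFun hc.choose_spec).mk'.mkContinuous hc.choose
    (norm_diagFun_le hc.choose_spec)

@[simp] lemma diagCLM_apply (c : ℕ → ℝ) (hc : ∃ C, ∀ n, |c n| ≤ C) (x : L2Pi) :
    diagCLM c hc x = diagFun c x := rfl

lemma isBoundedLinearMap_diagFun {c : ℕ → ℝ} {C : ℝ} (hc : ∀ n, |c n| ≤ C) :
    IsBoundedLinearMap ℝ (diagFun c) :=
  (diagCLM c ⟨C, hc⟩).isBoundedLinearMap

lemma diagFun_sineMode {c : ℕ → ℝ} {C : ℝ} (hc : ∀ n, |c n| ≤ C) (n : ℕ) :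
    diagFun c (sineMode n) = c n • sineMode n := by
  refine ext_inner_sineMode fun m => ?_
  rw [inner_diagFun hc, inner_smul_right, inner_sineMode_sineMode]
  split_ifs with h
  · rw [h]
  · simp

lemma smul_diagFun (r : ℝ) (c : ℕ → ℝ) (x : L2Pi) :
    r • diagFun c x = diagFun (fun n => r * c n) x := by
  rw [diagFun, diagFun, ← tsum_const_smul'']
  simp only [smul_smul, mul_assoc]

lemma diagFun_one (x : L2Pi) : diagFun (fun _ => 1) x = x :=
  ext_inner_sineMode fun n => by
    rw [inner_diagFun (C := 1) (fun _ => by simp), one_mul]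

lemma diagFun_diagFun {c d : ℕ → ℝ} {C D : ℝ} (hc : ∀ n, |c n| ≤ C) (hd : ∀ n, |d n| ≤ D)
    (x : L2Pi) : diagFun c (diagFun d x) = diagFun (fun n => c n * d n) x := by
  have hC : 0 ≤ C := (abs_nonneg _).trans (hc 0)
  have hcd : ∀ n, |c n * d n| ≤ C * D := fun n => by
    rw [abs_mul]; exact mul_le_mul (hc n) (hd n) (abs_nonneg _) hC
  exact ext_inner_sineMode fun n => by
    rw [inner_diagFun hc, inner_diagFun hd, inner_diagFun hcd, mul_assoc]

lemma aestronglyMeasurable_diagFun {μ : Measure ℝ} {c : ℕ → ℝ → ℝ} {x : ℝ → L2Pi}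
    (hc : ∀ n, AEStronglyMeasurable (c n) μ) (hx : AEStronglyMeasurable x μ)
    (hb : ∀ᵐ s ∂μ, ∃ C, ∀ n, |c n s| ≤ C) :
    AEStronglyMeasurable (fun s => diagFun (fun n => c n s) (x s)) μ := by
  refine aestronglyMeasurable_of_tendsto_ae atTop
    (f := fun (N : ℕ) s => ∑ n ∈ Finset.range N, (c n s * inner ℝ (sineMode n) (x s)) • sineMode n)
    (fun N => ?_) ?_
  · refine Finset.aestronglyMeasurable_fun_sum _ fun n _ => ?_
    exact ((hc n).mul (aestronglyMeasurable_const.inner hx)).smul_const _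
  · filter_upwards [hb] with s hs
    obtain ⟨C, hC⟩ := hs
    exact (hasSum_diagFun hC (x s)).tendsto_sum_nat

/-- A strong integral of diagonal operators is the diagonal operator of the integrals. -/
lemma integral_diagFun {μ : Measure ℝ} {c : ℕ → ℝ → ℝ} {g : ℝ → ℝ}
    (hc : ∀ n, AEStronglyMeasurable (c n) μ) (hg : Integrable g μ)
    (hb : ∀ᵐ s ∂μ, ∀ n, |c n s| ≤ g s) (x : L2Pi) :
    (∀ n, |∫ s, c n s ∂μ| ≤ ∫ s, g s ∂μ) ∧
    ∫ s, diagFun (fun n => c n s) x ∂μ = diagFun (fun n => ∫ s, c n s ∂μ) x := by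
  have hbd : ∀ n, |∫ s, c n s ∂μ| ≤ ∫ s, g s ∂μ := fun n => by
    rw [← Real.norm_eq_abs]
    exact norm_integral_le_of_norm_le hg (hb.mono fun s hs => hs n)
  refine ⟨hbd, ?_⟩
  have hint : Integrable (fun s => diagFun (fun n => c n s) x) μ := by
    refine (hg.mul_const ‖x‖).mono' (aestronglyMeasurable_diagFun hc aestronglyMeasurable_const
      (hb.mono fun s hs => ⟨_, hs⟩)) ?_
    filter_upwards [hb] with s hs
    exact norm_diagFun_le hs x
  refine ext_inner_sineMode fun n => ?_
  rw [← integral_inner hint, inner_diagFun hbd, ← integral_mul_const]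
  refine integral_congr_ae ?_
  filter_upwards [hb] with s hs
  exact inner_diagFun hs x n

/-! ### The heat semigroup -/

lemma abs_heat_coeff_le {t : ℝ} (ht : 0 ≤ t) (n : ℕ) :
    |Real.exp (-((n : ℝ) + 1) ^ 2 * t)| ≤ 1 := by
  rw [Real.abs_exp, Real.exp_le_one_iff, neg_mul]
  exact neg_nonpos.2 (by positivity)

lemma abs_window_coeff_le (t : ℝ) (n : ℕ) :
    |if 1 - 1 / ((n : ℝ) + 1) ^ 2 ≤ t then (1 : ℝ) else 0| ≤ 1 := by
  split_ifs <;> simp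

lemma inner_heatSemigroup {t : ℝ} (ht : 0 ≤ t) (x : L2Pi) (n : ℕ) :
    inner ℝ (sineMode n) (heatSemigroup t x) =
      Real.exp (-((n : ℝ) + 1) ^ 2 * t) * inner ℝ (sineMode n) x :=
  inner_diagFun (abs_heat_coeff_le ht) x n

/-- Dominated convergence in coordinates. -/
lemma tendsto_of_inner_sineMode {f : ℝ → L2Pi} {x : L2Pi} {l : Filter ℝ} {b : ℕ → ℝ}
    (hb : Summable b)
    (hlim : ∀ n, Tendsto (fun t => inner ℝ (sineMode n) (f t)) l (𝓝 (inner ℝ (sineMode n) x)))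
    (hbd : ∀ᶠ t in l, ∀ n, (inner ℝ (sineMode n) (f t) - inner ℝ (sineMode n) x) ^ 2 ≤ b n) :
    Tendsto f l (𝓝 x) := by
  rw [tendsto_iff_norm_sub_tendsto_zero]
  have h : Tendsto (fun t => ∑' n, (inner ℝ (sineMode n) (f t) - inner ℝ (sineMode n) x) ^ 2) l
      (𝓝 (∑' _ : ℕ, (0 : ℝ))) := by
    refine tendsto_tsum_of_dominated_convergence hb (fun n => ?_) ?_
    · have := ((hlim n).sub_const (inner ℝ (sineMode n) x)).pow 2
      simpa using this
    · filter_upwards [hbd] with t ht n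
      rw [Real.norm_of_nonneg (sq_nonneg _)]
      exact ht n
  rw [tsum_zero] at h
  have hsq : ∀ t, ‖f t - x‖ =
      Real.sqrt (∑' n, (inner ℝ (sineMode n) (f t) - inner ℝ (sineMode n) x) ^ 2) := by
    intro t
    have := (hasSum_sq_inner_sineMode (f t - x)).tsum_eq
    simp only [inner_sub_right] at this
    rw [this, Real.sqrt_sq (norm_nonneg _)]
  simp_rw [hsq]
  simpa using h.sqrt

lemma isC0Semigroup_heatSemigroup : IsC0Semigroup heatSemigroup := by
  refine ⟨fun t ht => isBoundedLinearMap_diagFun (abs_heat_coeff_le ht), fun t s ht hs x => ?_,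
    fun x => ?_, fun x => ?_⟩
  · refine ext_inner_sineMode fun n => ?_
    rw [inner_heatSemigroup (add_nonneg ht hs), inner_heatSemigroup ht, inner_heatSemigroup hs,
      mul_add, Real.exp_add, mul_assoc]
  · refine ext_inner_sineMode fun n => ?_
    rw [inner_heatSemigroup le_rfl]
    simp
  · refine tendsto_of_inner_sineMode (hasSum_sq_inner_sineMode x).summable (fun n => ?_) ?_
    · have hc : Tendsto (fun t : ℝ => Real.exp (-((n : ℝ) + 1) ^ 2 * t) *
          inner ℝ (sineMode n) x) (𝓝 0) (𝓝 (Real.exp (-((n : ℝ) + 1) ^ 2 * 0) *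
          inner ℝ (sineMode n) x)) := Continuous.tendsto (by fun_prop) 0
      rw [mul_zero, Real.exp_zero, one_mul] at hc
      refine (hc.mono_left nhdsWithin_le_nhds).congr' ?_
      filter_upwards [self_mem_nhdsWithin] with t ht
      exact (inner_heatSemigroup (le_of_lt ht) x n).symm
    · filter_upwards [self_mem_nhdsWithin] with t ht n
      have ht' : 0 ≤ t := le_of_lt ht
      rw [inner_heatSemigroup ht', ← sub_one_mul, mul_pow]
      have h1 := abs_heat_coeff_le ht' n
      rw [Real.abs_exp] at h1
      have h2 := Real.exp_pos (-((n : ℝ) + 1) ^ 2 * t)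
      have h3 : (Real.exp (-((n : ℝ) + 1) ^ 2 * t) - 1) ^ 2 ≤ 1 := by nlinarith
      nlinarith [sq_nonneg (inner ℝ (sineMode n) x)]

lemma norm_windowB_le (t : ℝ) (w : L2Pi) : ‖windowB t w‖ ≤ ‖w‖ := by
  rw [windowB_eq_diagFun]
  simpa using norm_diagFun_le (fun n => abs_window_coeff_le t n) w

/-! ### The generator of the heat semigroup -/

lemma ContDiff.absolutelyContinuousOnInterval {f : ℝ → ℝ} (hf : ContDiff ℝ 1 f) (a b : ℝ) :
    AbsolutelyContinuousOnInterval f a b :=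
  hf.contDiffOn.absolutelyContinuousOnInterval

/-- Two integrations by parts: `⟨e_m, y''⟩ = -m² ⟨e_m, y⟩`. -/
lemma inner_sineMode_of_dirichletLaplacian {y z : L2Pi} (h : dirichletLaplacian y z) (n : ℕ) :
    inner ℝ (sineMode n) z = -((n : ℝ) + 1) ^ 2 * inner ℝ (sineMode n) y := by
  obtain ⟨f, f', hf, hf', hd, hd', h0, hπ, hy⟩ := h
  have hpos := Real.pi_pos
  set k : ℝ := (n : ℝ) + 1 with hk
  have hsin : ∀ s : ℝ, HasDerivAt (fun s => Real.sin (k * s)) (k * Real.cos (k * s)) s :=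
    fun s => by
    have := ((hasDerivAt_id s).const_mul k).sin
    simpa [mul_comm] using this
  have hcos : ∀ s : ℝ, HasDerivAt (fun s => k * Real.cos (k * s)) (-k ^ 2 * Real.sin (k * s)) s :=
    fun s => by
      have := (((hasDerivAt_id s).const_mul k).cos).const_mul k
      refine this.congr_deriv ?_
      simp only [id]
      ring
  have hsinπ : Real.sin (k * Real.pi) = 0 := by
    have := Real.sin_nat_mul_pi (n + 1)
    rwa [Nat.cast_add, Nat.cast_one] at this
  have e1 : ∫ s in (0 : ℝ)..Real.pi, Real.sin (k * s) * z s =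
      ∫ s in (0 : ℝ)..Real.pi, Real.sin (k * s) * deriv f' s := by
    rw [intervalIntegral.integral_of_le hpos.le, intervalIntegral.integral_of_le hpos.le,
      ← integral_Icc_eq_integral_Ioc, ← integral_Icc_eq_integral_Ioc]
    refine integral_congr_ae ?_
    filter_upwards [hd'] with s hs
    rw [hs.deriv]
  have e2 := (ContDiff.absolutelyContinuousOnInterval (f := fun s => Real.sin (k * s))
    (by fun_prop) 0 Real.pi).integral_mul_deriv_eq_deriv_mul hf'
  have e3 : ∫ s in (0 : ℝ)..Real.pi, deriv (fun s => Real.sin (k * s)) s * f' s =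
      ∫ s in (0 : ℝ)..Real.pi, (k * Real.cos (k * s)) * deriv f s := by
    refine intervalIntegral.integral_congr_ae ?_
    have hne : ∀ᵐ s ∂(volume : Measure ℝ), s ≠ Real.pi := by simp [ae_iff, measure_singleton]
    filter_upwards [hne] with s hs hmem
    rw [uIoc_of_le hpos.le] at hmem
    have hlt : s < Real.pi := lt_of_le_of_ne hmem.2 hs
    have := (hd s ⟨hmem.1.le, hmem.2⟩).hasDerivAt (Icc_mem_nhds hmem.1 hlt)
    rw [this.deriv, (hsin s).deriv]
  have e4 := (ContDiff.absolutelyContinuousOnInterval (f := fun s => k * Real.cos (k * s))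
    (by fun_prop) 0 Real.pi).integral_mul_deriv_eq_deriv_mul hf
  have e5 : ∫ s in (0 : ℝ)..Real.pi, deriv (fun s => k * Real.cos (k * s)) s * f s =
      -k ^ 2 * ∫ s in (0 : ℝ)..Real.pi, Real.sin (k * s) * y s := by
    rw [← intervalIntegral.integral_const_mul, intervalIntegral.integral_of_le hpos.le,
      intervalIntegral.integral_of_le hpos.le, ← integral_Icc_eq_integral_Ioc,
      ← integral_Icc_eq_integral_Ioc]
    refine integral_congr_ae ?_
    filter_upwards [hy] with s hs
    rw [hs, (hcos s).deriv, mul_assoc]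
  rw [inner_sineMode, inner_sineMode, ← hk, e1, e2, e3, e4, e5, h0, hπ, hsinπ]
  simp
  ring

lemma tendsto_inner_heatSemigroup_quotient (x : L2Pi) (n : ℕ) :
    Tendsto (fun t : ℝ => inner ℝ (sineMode n) (t⁻¹ • (heatSemigroup t x - x))) (𝓝[>] 0)
      (𝓝 (-((n : ℝ) + 1) ^ 2 * inner ℝ (sineMode n) x)) := by
  have hd : HasDerivAt (fun t : ℝ => Real.exp (-((n : ℝ) + 1) ^ 2 * t)) (-((n : ℝ) + 1) ^ 2) 0 := by
    have := ((hasDerivAt_id (0 : ℝ)).const_mul (-((n : ℝ) + 1) ^ 2)).exp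
    simpa using this
  have h := (hasDerivAt_iff_tendsto_slope_zero.1 hd).mono_left
    (nhdsWithin_mono 0 (fun t (ht : t ∈ Ioi (0 : ℝ)) => ne_of_gt ht))
  refine (h.mul_const (inner ℝ (sineMode n) x)).congr' ?_
  filter_upwards [self_mem_nhdsWithin] with t ht
  rw [inner_smul_right, inner_sub_right, inner_heatSemigroup (le_of_lt ht)]
  simp
  ring

/-- Convergence of the difference quotients when `x` has the coordinates of an element of the
domain: by `0 ≤ (e ^ (-a t) - 1) / t + a ≤ a` they are dominated by the coordinates of the limit. -/
lemma tendsto_heatSemigroup_quotient {x z : L2Pi}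
    (h : ∀ n : ℕ, inner ℝ (sineMode n) z = -((n : ℝ) + 1) ^ 2 * inner ℝ (sineMode n) x) :
    Tendsto (fun t : ℝ => t⁻¹ • (heatSemigroup t x - x)) (𝓝[>] 0) (𝓝 z) := by
  refine tendsto_of_inner_sineMode (hasSum_sq_inner_sineMode z).summable (fun n => ?_) ?_
  · rw [h n]
    exact tendsto_inner_heatSemigroup_quotient x n
  · filter_upwards [self_mem_nhdsWithin] with t ht n
    have ht' : 0 < t := ht
    rw [inner_smul_right, inner_sub_right, inner_heatSemigroup ht'.le, h n]
    set a : ℝ := ((n : ℝ) + 1) ^ 2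
    have ha : 0 ≤ a := sq_nonneg _
    set E := Real.exp (-a * t)
    have h1 : -a * t + 1 ≤ E := Real.add_one_le_exp _
    have h2 : E ≤ 1 := Real.exp_le_one_iff.2 (by nlinarith)
    have h3 : 0 ≤ t⁻¹ * (E - 1) + a := by
      have : t⁻¹ * (E - 1) + a = t⁻¹ * (E - 1 + a * t) := by field_simp
      rw [this]
      exact mul_nonneg (inv_pos.2 ht').le (by linarith)
    have h4 : t⁻¹ * (E - 1) + a ≤ a := by
      have := mul_nonneg (inv_pos.2 ht').le (sub_nonneg.2 h2)
      linarith
    have h5 : t⁻¹ * (E * inner ℝ (sineMode n) x - inner ℝ (sineMode n) x) -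
        -a * inner ℝ (sineMode n) x = (t⁻¹ * (E - 1) + a) * inner ℝ (sineMode n) x := by ring
    rw [h5, mul_pow, mul_pow, neg_sq]
    exact mul_le_mul_of_nonneg_right (pow_le_pow_left₀ h3 h4 2) (sq_nonneg _)

/-- Every `z` has a preimage under the Dirichlet Laplacian: integrate twice, the constant being
chosen to satisfy the boundary condition at `π`. -/
lemma exists_dirichletLaplacian (z : L2Pi) : ∃ y, dirichletLaplacian y z := by
  have hpos := Real.pi_pos
  set Z : ℝ → ℝ := (Icc 0 Real.pi).indicator z with hZ
  have hZi : Integrable Z volume :=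
    (integrable_indicator_iff measurableSet_Icc).2 ((Lp.memLp z).integrable (by norm_num))
  set g : ℝ → ℝ := fun s => ∫ r in (0 : ℝ)..s, Z r with hg
  have hgc : Continuous g := intervalIntegral.continuous_primitive (fun _ _ =>
    hZi.intervalIntegrable) 0
  set a : ℝ := -(∫ s in (0 : ℝ)..Real.pi, g s) / Real.pi with ha
  have hc : Continuous fun s => g s + a := by fun_prop
  have hfd : ∀ s, HasDerivAt (fun s => ∫ r in (0 : ℝ)..s, g r + a) (g s + a) s := fun s =>
    intervalIntegral.integral_hasDerivAt_right (hc.intervalIntegrable _ _)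
      (hc.stronglyMeasurableAtFilter _ _) hc.continuousAt
  have hfc : Continuous fun s => ∫ r in (0 : ℝ)..s, g r + a :=
    continuous_iff_continuousAt.2 fun s => (hfd s).continuousAt
  refine ⟨contL2 _ hfc, _, fun s => g s + a, ?_, ?_, fun s _ => (hfd s).hasDerivWithinAt, ?_, ?_,
    ?_,
    coeFn_contL2 _ hfc⟩
  · exact (hc.intervalIntegrable _ _).absolutelyContinuousOnInterval_intervalIntegral left_mem_uIcc
  · exact (hZi.intervalIntegrable.absolutelyContinuousOnInterval_intervalIntegral left_mem_uIcc).add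
      (ContDiff.absolutelyContinuousOnInterval contDiff_const 0 Real.pi)
  · rw [ae_restrict_iff' measurableSet_Icc]
    filter_upwards [_root_.LocallyIntegrable.ae_hasDerivAt_integral hZi.locallyIntegrable] with s
      hs hmem
    have := (hs 0).add_const a
    rwa [hZ, indicator_of_mem hmem] at this
  · simp
  · rw [intervalIntegral.integral_add (hgc.intervalIntegrable _ _) (by simp),
      intervalIntegral.integral_const, ha]
    simp only [sub_zero, smul_eq_mul]
    field_simp
    ring

/-- If the difference quotients of `x` converge to `z`, then `x` has the same coordinates as the
solution `y` of `y'' = z`, so `x` lies in the domain. -/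
lemma isGeneratorOf_dirichletLaplacian : IsGeneratorOf dirichletLaplacian heatSemigroup := by
  intro x z
  refine ⟨fun h => tendsto_heatSemigroup_quotient (inner_sineMode_of_dirichletLaplacian h),
    fun h => ?_⟩
  obtain ⟨y, hy⟩ := exists_dirichletLaplacian z
  suffices y = x from this ▸ hy
  refine ext_inner_sineMode fun n => ?_
  have h1 : Tendsto (fun t : ℝ => inner ℝ (sineMode n) (t⁻¹ • (heatSemigroup t x - x))) (𝓝[>] 0)
      (𝓝 (inner ℝ (sineMode n) z)) := tendsto_const_nhds.inner h
  have h2 := tendsto_nhds_unique h1 (tendsto_inner_heatSemigroup_quotient x n)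
  rw [inner_sineMode_of_dirichletLaplacian hy n] at h2
  exact mul_left_cancel₀ (neg_ne_zero.2 (by positivity)) h2

/-! ### The fractional solution operators -/

/-- The eigenvalue on `sineMode n`, `∫ ω(θ) e ^ (-(n + 1)² t ^ α θ) dθ` of the operator
`∫ ω(θ) S(t ^ α θ) dθ` subordinated to the heat semigroup with weight `ω`. -/
noncomputable def subordCoeff (ω : ℝ → ℝ) (α : ℝ) (n : ℕ) (t : ℝ) : ℝ :=
  ∫ θ in Ioi (0 : ℝ), ω θ * Real.exp (-((n : ℝ) + 1) ^ 2 * (t ^ α * θ))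

lemma abs_subord_integrand_le (ω : ℝ → ℝ) (α : ℝ) {t θ : ℝ} (ht : 0 ≤ t) (hθ : θ ∈ Ioi (0 : ℝ))
    (n : ℕ) : |ω θ * Real.exp (-((n : ℝ) + 1) ^ 2 * (t ^ α * θ))| ≤ |ω θ| := by
  have hθ' : 0 < θ := hθ
  rw [abs_mul]
  exact mul_le_of_le_one_right (abs_nonneg _) (abs_heat_coeff_le (by positivity) n)

lemma integral_smul_heatSemigroup {ω : ℝ → ℝ} (hω : IntegrableOn ω (Ioi 0)) (α : ℝ) {t : ℝ}
    (ht : 0 ≤ t) :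
    (∀ n, |subordCoeff ω α n t| ≤ ∫ θ in Ioi (0 : ℝ), |ω θ|) ∧
    ∀ x, ∫ θ in Ioi (0 : ℝ), ω θ • heatSemigroup (t ^ α * θ) x =
      diagFun (fun n => subordCoeff ω α n t) x := by
  have h := integral_diagFun (μ := volume.restrict (Ioi (0 : ℝ)))
    (c := fun n θ => ω θ * Real.exp (-((n : ℝ) + 1) ^ 2 * (t ^ α * θ))) (g := fun θ => |ω θ|)
    (fun n => hω.aestronglyMeasurable.mul (Measurable.aestronglyMeasurable (by fun_prop))) hω.abs
    ((ae_restrict_mem measurableSet_Ioi).mono fun θ hθ n => abs_subord_integrand_le ω α ht hθ n)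
  refine ⟨(h 0).1, fun x => ?_⟩
  simp only [heatSemigroup_eq_diagFun, smul_diagFun]
  exact (h x).2

lemma continuousOn_subordCoeff {ω : ℝ → ℝ} (hω : IntegrableOn ω (Ioi 0)) {α : ℝ} (hα : 0 < α)
    (n : ℕ) : ContinuousOn (subordCoeff ω α n) (Ici 0) := by
  refine continuousOn_of_dominated (bound := fun θ => |ω θ|)
    (fun t _ => hω.aestronglyMeasurable.mul (Measurable.aestronglyMeasurable (by fun_prop)))
    (fun t ht => ?_) hω.abs ?_
  · filter_upwards [ae_restrict_mem measurableSet_Ioi] with θ hθ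
    exact abs_subord_integrand_le ω α ht hθ n
  · refine Eventually.of_forall fun θ => Continuous.continuousOn ?_
    have := Real.continuous_rpow_const hα.le
    fun_prop

lemma subordCoeff_zero (ω : ℝ → ℝ) {α : ℝ} (hα : 0 < α) (n : ℕ) :
    subordCoeff ω α n 0 = ∫ θ in Ioi (0 : ℝ), ω θ := by
  simp [subordCoeff, Real.zero_rpow hα.ne']

lemma fracS_heat_eq {α t : ℝ} (hα0 : 0 < α) (hα : α < 1) (ht : 0 ≤ t) (x : L2Pi) :
    fracS heatSemigroup α t x = diagFun (fun n => subordCoeff (wright α) α n t) x :=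
  (integral_smul_heatSemigroup (integrableOn_wright hα0 hα) α ht).2 x

lemma fracP_heat_eq {α t : ℝ} (hα0 : 0 < α) (hα : α < 1) (ht : 0 ≤ t) (x : L2Pi) :
    fracP heatSemigroup α t x =
      diagFun (fun n => subordCoeff (fun θ => α * θ * wright α θ) α n t) x :=
  (integral_smul_heatSemigroup (integrableOn_mul_wright hα0 hα) α ht).2 x

/-- `𝒮_α(0)` is the identity because the Wright function has total mass one. -/
lemma fracS_heat_zero {α : ℝ} (hα0 : 0 < α) (hα : α < 1) (x : L2Pi) :
    fracS heatSemigroup α 0 x = x := by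
  rw [fracS_heat_eq hα0 hα le_rfl]
  simp only [subordCoeff_zero _ hα0, integral_wright hα0 hα]
  exact diagFun_one x

/-- `𝒮_α(t)` for `t ≥ 0`, as a continuous linear map. -/
lemma exists_fracS_heat_CLM {α t : ℝ} (hα0 : 0 < α) (hα : α < 1) (ht : 0 ≤ t) :
    ∃ A : L2Pi →L[ℝ] L2Pi, ∀ x, A x = fracS heatSemigroup α t x :=
  ⟨diagCLM _ ⟨_, (integral_smul_heatSemigroup (integrableOn_wright hα0 hα) α ht).1⟩,
    fun x => by rw [diagCLM_apply, fracS_heat_eq hα0 hα ht]⟩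

/-! ### The control integrals -/

/-- Integration of a square integrable control against a family of diagonal operators whose norms
are square integrable in time. -/
lemma exists_integral_diagFun_CLM {μ : Measure ℝ} {c : ℕ → ℝ → ℝ} {g : ℝ → ℝ}
    (hc : ∀ n, AEStronglyMeasurable (c n) μ) (hg : MemLp g 2 μ)
    (hb : ∀ᵐ s ∂μ, ∀ n, |c n s| ≤ g s) :
    ∃ T : Lp L2Pi 2 μ →L[ℝ] L2Pi, ∀ u, T u = ∫ s, diagFun (fun n => c n s) (u s) ∂μ := by
  have hgu : ∀ u : Lp L2Pi 2 μ, Integrable (fun s => g s * ‖u s‖) μ := fun u =>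
    hg.integrable_mul (Lp.memLp u).norm
  have hle : ∀ u : Lp L2Pi 2 μ,
      ∀ᵐ s ∂μ, ‖diagFun (fun n => c n s) (u s)‖ ≤ g s * ‖u s‖ := fun u =>
    hb.mono fun s hs => norm_diagFun_le hs (u s)
  have hint : ∀ u : Lp L2Pi 2 μ, Integrable (fun s => diagFun (fun n => c n s) (u s)) μ := fun u =>
    (hgu u).mono' (aestronglyMeasurable_diagFun hc (Lp.aestronglyMeasurable u)
      (hb.mono fun s hs => ⟨_, hs⟩)) (hle u)
  let T₀ : Lp L2Pi 2 μ →ₗ[ℝ] L2Pi :=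
    { toFun := fun u => ∫ s, diagFun (fun n => c n s) (u s) ∂μ
      map_add' := fun u v => by
        rw [← integral_add (hint u) (hint v)]
        refine integral_congr_ae ?_
        filter_upwards [Lp.coeFn_add u v, hb] with s hs hbs
        rw [hs, Pi.add_apply, (isLinearMap_diagFun hbs).map_add]
      map_smul' := fun r u => by
        rw [RingHom.id_apply, ← integral_smul]
        refine integral_congr_ae ?_
        filter_upwards [Lp.coeFn_smul r u, hb] with s hs hbs
        rw [hs, Pi.smul_apply, (isLinearMap_diagFun hbs).map_smul] }
  refine ⟨T₀.mkContinuous ‖hg.toLp g‖ fun u => ?_, fun u => rfl⟩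
  -- Cauchy–Schwarz for `g` and `‖u‖`
  calc ‖∫ s, diagFun (fun n => c n s) (u s) ∂μ‖ ≤ ∫ s, g s * ‖u s‖ ∂μ :=
        norm_integral_le_of_norm_le (hgu u) (hle u)
    _ = inner ℝ (hg.toLp g) ((Lp.memLp u).norm.toLp _) := by
        rw [L2.inner_def]
        refine integral_congr_ae ?_
        filter_upwards [hg.coeFn_toLp, (Lp.memLp u).norm.coeFn_toLp] with s h1 h2
        rw [h1, h2]
        simp [mul_comm]
    _ ≤ ‖hg.toLp g‖ * ‖(Lp.memLp u).norm.toLp _‖ := real_inner_le_norm _ _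
    _ = ‖hg.toLp g‖ * ‖u‖ := by
        rw [Lp.norm_toLp _ (Lp.memLp u).norm, eLpNorm_norm, ← Lp.norm_def]

open Classical in
/-- The eigenvalue on `sineMode n` of `(t - s) ^ (α - 1) 𝒫_α(t - s) B(s)`, extended by zero outside
`(τ, t]`. -/
noncomputable def controlCoeff (α τ t : ℝ) (n : ℕ) (s : ℝ) : ℝ :=
  (Ioc τ t).indicator (fun s => (t - s) ^ (α - 1) *
    (subordCoeff (fun θ => α * θ * wright α θ) α n (t - s) *
      if 1 - 1 / ((n : ℝ) + 1) ^ 2 ≤ s then 1 else 0)) s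

lemma abs_controlCoeff_le {α τ t s : ℝ} (hα0 : 0 < α) (hα : α < 1) (hs : s ∈ Ioc τ t) (n : ℕ) :
    |controlCoeff α τ t n s| ≤
      (t - s) ^ (α - 1) * ∫ θ in Ioi (0 : ℝ), |α * θ * wright α θ| := by
  have hst : 0 ≤ t - s := sub_nonneg.2 hs.2
  simp only [controlCoeff, indicator_of_mem hs]
  rw [abs_mul, abs_mul, abs_of_nonneg (Real.rpow_nonneg hst _)]
  refine mul_le_mul_of_nonneg_left ?_ (Real.rpow_nonneg hst _)
  exact (mul_le_of_le_one_right (abs_nonneg _) (abs_window_coeff_le s n)).trans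
    ((integral_smul_heatSemigroup (integrableOn_mul_wright hα0 hα) α hst).1 n)

lemma intervalIntegral_control_eq {α τ t : ℝ} (hα0 : 0 < α) (hα : α < 1) (hτ : 0 ≤ τ) (hτt : τ ≤ t)
    (ht : t ≤ 1) (u : ℝ → L2Pi) :
    ∫ s in τ..t, (t - s) ^ (α - 1) • fracP heatSemigroup α (t - s) (windowB s (u s)) =
      ∫ s in Icc (0 : ℝ) 1, diagFun (fun n => controlCoeff α τ t n s) (u s) := by
  classical
  have h1 : ∀ s, diagFun (fun n => controlCoeff α τ t n s) (u s) =
      (Ioc τ t).indicator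
        (fun s => (t - s) ^ (α - 1) • fracP heatSemigroup α (t - s) (windowB s (u s))) s := by
    intro s
    by_cases hs : s ∈ Ioc τ t
    · have hst : 0 ≤ t - s := sub_nonneg.2 hs.2
      rw [indicator_of_mem hs, fracP_heat_eq hα0 hα hst, windowB_eq_diagFun,
        diagFun_diagFun (integral_smul_heatSemigroup (integrableOn_mul_wright hα0 hα) α hst).1
          (abs_window_coeff_le s), smul_diagFun]
      simp only [controlCoeff, indicator_of_mem hs]
    · rw [indicator_of_notMem hs]
      simp only [controlCoeff, indicator_of_notMem hs]
      simp [diagFun]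
  have hsub : Ioc τ t ⊆ Icc (0 : ℝ) 1 := fun s hs => ⟨hτ.trans hs.1.le, hs.2.trans ht⟩
  simp_rw [h1]
  rw [intervalIntegral.integral_of_le hτt, setIntegral_indicator measurableSet_Ioc,
    inter_eq_right.2 hsub]

/-- The control integrals are bounded on `L²` when `α > 1/2`: the singularity `(t - s) ^ (α - 1)` is
then square integrable. -/
lemma exists_control_CLM {α τ t : ℝ} (hα0 : 1 / 2 < α) (hα : α < 1) (hτ : 0 ≤ τ) (hτt : τ ≤ t)
    (ht : t ≤ 1) :
    ∃ T : Lp L2Pi 2 (volume.restrict (Icc (0 : ℝ) 1)) →L[ℝ] L2Pi, ∀ u, T u =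
      ∫ s in τ..t, (t - s) ^ (α - 1) • fracP heatSemigroup α (t - s) (windowB s (u s)) := by
  classical
  have hα' : 0 < α := by linarith
  have hP := integrableOn_mul_wright hα' hα
  set C := ∫ θ in Ioi (0 : ℝ), |α * θ * wright α θ| with hC
  set g : ℝ → ℝ := (Ioc τ t).indicator fun s => (t - s) ^ (α - 1) * C with hg
  have hgm : MemLp g 2 (volume.restrict (Icc (0 : ℝ) 1)) := by
    rw [memLp_two_iff_integrable_sq
      (Measurable.aestronglyMeasurable (Measurable.indicator (by fun_prop) measurableSet_Ioc))]
    refine Integrable.mono_measure ?_ Measure.restrict_le_self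
    have hsq : (fun s => g s ^ 2) = (Ioc τ t).indicator fun s => (t - s) ^ (2 * (α - 1)) * C ^ 2
      := by
      funext s
      by_cases hs : s ∈ Ioc τ t
      · rw [hg, indicator_of_mem hs, indicator_of_mem hs, mul_pow, ← Real.rpow_natCast,
          ← Real.rpow_mul (sub_nonneg.2 hs.2)]
        push_cast
        rw [mul_comm (α - 1)]
      · rw [hg, indicator_of_notMem hs, indicator_of_notMem hs]
        simp
    rw [hsq, integrable_indicator_iff measurableSet_Ioc,
      ← intervalIntegrable_iff_integrableOn_Ioc_of_le hτt]
    have h := (intervalIntegral.intervalIntegrable_rpow' (a := t - τ) (b := t - t)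
      (r := 2 * (α - 1)) (by linarith)).comp_sub_left t
    simp only [sub_sub_cancel] at h
    exact h.mul_const _
  have hcm : ∀ n, AEStronglyMeasurable (controlCoeff α τ t n) (volume.restrict (Icc (0 : ℝ) 1)) :=
    by
    intro n
    refine AEStronglyMeasurable.mono_measure ?_ Measure.restrict_le_self
    have hm : AEStronglyMeasurable (fun s => (t - s) ^ (α - 1) *
        (subordCoeff (fun θ => α * θ * wright α θ) α n (t - s) *
          if 1 - 1 / ((n : ℝ) + 1) ^ 2 ≤ s then 1 else 0)) (volume.restrict (Ioc τ t)) := by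
      refine (Measurable.aestronglyMeasurable (by fun_prop)).mul (AEStronglyMeasurable.mul ?_
        (Measurable.aestronglyMeasurable (Measurable.ite (measurableSet_le measurable_const
          measurable_id) measurable_const measurable_const)))
      refine ContinuousOn.aestronglyMeasurable ?_ measurableSet_Ioc
      exact (continuousOn_subordCoeff hP hα' n).comp (by fun_prop)
        fun s hs => sub_nonneg.2 hs.2
    exact (aestronglyMeasurable_indicator_iff measurableSet_Ioc).2 hm
  have hcb : ∀ s n, |controlCoeff α τ t n s| ≤ g s := by
    intro s n
    by_cases hs : s ∈ Ioc τ t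
    · rw [hg, indicator_of_mem hs]
      exact abs_controlCoeff_le hα' hα hs n
    · simp only [controlCoeff, hg, indicator_of_notMem hs, abs_zero, le_refl]
  obtain ⟨T, hT⟩ := exists_integral_diagFun_CLM hcm hgm (Eventually.of_forall hcb)
  exact ⟨T, fun u => by rw [hT u, intervalIntegral_control_eq hα' hα hτ hτt ht]⟩

/-! ### Reachable modes -/

/-- A control acting only shortly before the final time, along a single sine mode that is active
there, leaves the earlier control integral zero and reaches a nonzero multiple of that mode: near the
final time the integrand is positive, because the eigenvalue of `𝒫_α` at `0` is `1 / Γ(α)`. -/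
lemma exists_control_reaching_sineMode {α τ : ℝ} (hα0 : 1 / 2 < α) (hα : α < 1) (hτ : 0 ≤ τ)
    (hτ1 : τ < 1) (n : ℕ) :
    ∃ (u : Lp L2Pi 2 (volume.restrict (Icc (0 : ℝ) 1))) (κ : ℝ), κ ≠ 0 ∧
      ∫ s in (0 : ℝ)..τ, (τ - s) ^ (α - 1) • fracP heatSemigroup α (τ - s) (windowB s (u s)) = 0 ∧
      ∫ s in τ..1, (1 - s) ^ (α - 1) • fracP heatSemigroup α (1 - s) (windowB s (u s)) =
        κ • sineMode n := by
  classical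
  have hα' : 0 < α := by linarith
  have hP := integrableOn_mul_wright hα' hα
  set p : ℝ → ℝ := subordCoeff (fun θ => α * θ * wright α θ) α n with hp
  have hpc : ContinuousOn p (Ici 0) := continuousOn_subordCoeff hP hα' n
  have hp0 : 0 < p 0 := by
    rw [hp, subordCoeff_zero _ hα', integral_mul_wright hα' hα]
    exact inv_pos.2 (Real.Gamma_pos_of_pos hα')
  obtain ⟨ε, hε, hpos⟩ : ∃ ε > 0, ∀ t, 0 ≤ t → t < ε → 0 < p t := by
    have h := (hpc 0 self_mem_Ici).eventually (lt_mem_nhds hp0)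
    obtain ⟨ε, hε, hball⟩ := Metric.mem_nhdsWithin_iff.1 h
    refine ⟨ε, hε, fun t ht htε => hball ⟨?_, ht⟩⟩
    rw [Metric.mem_ball, Real.dist_eq, sub_zero, abs_of_nonneg ht]
    exact htε
  obtain ⟨δ, hδ, hδε, hδτ, hδn⟩ : ∃ δ > 0, δ < ε ∧ δ ≤ 1 - τ ∧ δ ≤ 1 / ((n : ℝ) + 1) ^ 2 := by
    have hn : (0 : ℝ) < 1 / ((n : ℝ) + 1) ^ 2 := by positivity
    refine ⟨min (ε / 2) (min (1 - τ) (1 / ((n : ℝ) + 1) ^ 2)),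
      lt_min (half_pos hε) (lt_min (by linarith) hn), ?_,
      (min_le_right _ _).trans (min_le_left _ _), (min_le_right _ _).trans (min_le_right _ _)⟩
    exact (min_le_left _ _).trans_lt (half_lt_self hε)
  have hμ : (volume.restrict (Icc (0 : ℝ) 1)) (Ioc (1 - δ) 1) ≠ ⊤ := measure_ne_top _ _
  set u : Lp L2Pi 2 (volume.restrict (Icc (0 : ℝ) 1)) :=
    indicatorConstLp 2 measurableSet_Ioc hμ (sineMode n) with hu
  have hucoe : ∀ᵐ s ∂(volume.restrict (Icc (0 : ℝ) 1)),
      u s = (Ioc (1 - δ) 1).indicator (fun _ => sineMode n) s := indicatorConstLp_coeFn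
  set φ : ℝ → ℝ := fun s => (1 - s) ^ (α - 1) * p (1 - s) with hφ
  refine ⟨u, ∫ s in (1 - δ)..1, φ s, ?_, ?_, ?_⟩
  · refine (intervalIntegral.intervalIntegral_pos_of_pos_on ?_ (fun s hs => ?_) (by linarith)).ne'
    · refine IntervalIntegrable.mul_continuousOn ?_ (hpc.comp (by fun_prop) fun s hs => ?_)
      · have h := (intervalIntegral.intervalIntegrable_rpow' (a := δ) (b := 0)
          (r := α - 1) (by linarith)).comp_sub_left 1
        simpa using h
      · rw [uIcc_of_le (by linarith)] at hs
        exact sub_nonneg.2 hs.2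
    · exact mul_pos (Real.rpow_pos_of_pos (by linarith [hs.2]) _)
        (hpos _ (by linarith [hs.2]) (by linarith [hs.1]))
  · rw [intervalIntegral_control_eq hα' hα le_rfl hτ hτ1.le]
    refine integral_eq_zero_of_ae ?_
    filter_upwards [hucoe] with s hs
    rw [hs]
    by_cases h1 : s ∈ Ioc (1 - δ) 1
    · have h2 : s ∉ Ioc 0 τ := fun h => by linarith [h.2, h1.1]
      simp only [controlCoeff, indicator_of_notMem h2]
      simp [diagFun]
    · rw [indicator_of_notMem h1]
      simp [diagFun]
  · rw [intervalIntegral_control_eq hα' hα hτ hτ1.le le_rfl,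
      intervalIntegral.integral_of_le (by linarith), ← integral_smul_const]
    have hsub : Ioc (1 - δ) 1 ⊆ Icc (0 : ℝ) 1 := fun s hs => ⟨by linarith [hs.1], hs.2⟩
    rw [← inter_eq_right.2 hsub, ← setIntegral_indicator measurableSet_Ioc]
    refine integral_congr_ae ?_
    filter_upwards [hucoe] with s hs
    rw [hs]
    by_cases h1 : s ∈ Ioc (1 - δ) 1
    · have h2 : s ∈ Ioc τ 1 := ⟨by linarith [h1.1], h1.2⟩
      have h3 : 1 - 1 / ((n : ℝ) + 1) ^ 2 ≤ s := by linarith [h1.1]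
      have hst : 0 ≤ 1 - s := sub_nonneg.2 h1.2
      have hbd : ∀ m, |controlCoeff α τ 1 m s| ≤
          (1 - s) ^ (α - 1) * ∫ θ in Ioi (0 : ℝ), |α * θ * wright α θ| :=
        fun m => abs_controlCoeff_le hα' hα h2 m
      rw [indicator_of_mem h1, indicator_of_mem h1, diagFun_sineMode hbd, controlCoeff,
        indicator_of_mem h2, if_pos h3, mul_one]
    · rw [indicator_of_notMem h1, indicator_of_notMem h1]
      simp [diagFun]

/-- The range is a subspace containing all sine modes, which span a dense subspace. -/
lemma denseRange_of_reaches_sineModes {E : Type*} [NormedAddCommGroup E] [NormedSpace ℝ E]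
    (L : E →L[ℝ] L2Pi) (h : ∀ n, ∃ (u : E) (κ : ℝ), κ ≠ 0 ∧ L u = κ • sineMode n) :
    DenseRange L := by
  have hle : Submodule.span ℝ (range sineMode) ≤ LinearMap.range (L : E →ₗ[ℝ] L2Pi) := by
    rw [Submodule.span_le]
    rintro _ ⟨n, rfl⟩
    obtain ⟨u, κ, hκ, hu⟩ := h n
    refine ⟨κ⁻¹ • u, ?_⟩
    rw [ContinuousLinearMap.coe_coe, map_smul, hu, smul_smul, inv_mul_cancel₀ hκ, one_smul]
  have hd : Dense (Submodule.span ℝ (range sineMode) : Set L2Pi) := by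
    rw [Submodule.dense_iff_topologicalClosure_eq_top, ← coe_sineBasis]
    exact sineBasis.dense_span
  exact hd.mono hle

/-! ### The impulsive system -/

lemma adjoint_injective_of_surjective {E F : Type*} [NormedAddCommGroup E] [InnerProductSpace ℝ E]
    [CompleteSpace E] [NormedAddCommGroup F] [InnerProductSpace ℝ F] [CompleteSpace F]
    (M : E →L[ℝ] F) (hM : Function.Surjective M) (h : F)
    (h0 : ContinuousLinearMap.adjoint M h = 0) : h = 0 := by
  obtain ⟨x, rfl⟩ := hM h
  rw [← inner_self_eq_zero (𝕜 := ℝ), ← ContinuousLinearMap.adjoint_inner_right, h0,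
    inner_zero_right]

lemma heatSystem_evolve (u : ℝ → L2Pi) (τ t : ℝ) (x : L2Pi) :
    heatSystem.evolve u τ t x = fracS heatSemigroup (2 / 3) (t - τ) x +
      ∫ s in τ..t, (t - s) ^ ((2 / 3 : ℝ) - 1) •
        fracP heatSemigroup (2 / 3) (t - s) (windowB s (u s)) := rfl

lemma heatSystem_postImpulse_one (x₀ : L2Pi) (u : ℝ → L2Pi) (v : Fin 2 → L2Pi) :
    heatSystem.postImpulse x₀ u v 1 =
      (2 : ℝ) • heatSystem.evolve u 0 (1 / 2) x₀ + v 0 := by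
  rw [two_smul]
  rfl

lemma heatSystem_mildSolution_one (x₀ : L2Pi) (u : ℝ → L2Pi) (v : Fin 2 → L2Pi) :
    heatSystem.mildSolution x₀ u v 1 1 =
      heatSystem.evolve u (1 / 2) 1 (heatSystem.postImpulse x₀ u v 1) := rfl

lemma heatSystem_postImpulse_two (x₀ : L2Pi) (u : ℝ → L2Pi) (v : Fin 2 → L2Pi) :
    heatSystem.postImpulse x₀ u v 2 = (2 : ℝ) • heatSystem.mildSolution x₀ u v 1 1 + v 1 := by
  rw [two_smul]
  rfl

/-- At the final time the last evolution step is over an interval of length zero, so `ℳ` is the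
state after the second impulse. -/
lemma heatSystem_controllabilityMap (Ω : ControlSpace L2Pi 2 1) :
    heatSystem.controllabilityMap Ω =
      heatSystem.postImpulse 0 (Ω.fst : ℝ → L2Pi) (fun k => Ω.snd k) 2 := by
  change heatSystem.evolve _ 1 1 _ = _
  rw [heatSystem_evolve, sub_self, fracS_heat_zero (by norm_num) (by norm_num),
    intervalIntegral.integral_same, add_zero]
  rfl

/-- The operators from which all reachable states are assembled: `𝒮(1/2)` and the two control
integrals. -/
lemma exists_heat_solution_CLMs :
    ∃ (A : L2Pi →L[ℝ] L2Pi) (T₁ T₂ : Lp L2Pi 2 (volume.restrict (Icc (0 : ℝ) 1)) →L[ℝ] L2Pi),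
      (∀ x, A x = fracS heatSemigroup (2 / 3) (1 / 2) x) ∧
      (∀ u, T₁ u = ∫ s in (0 : ℝ)..(1 / 2), (1 / 2 - s) ^ ((2 / 3 : ℝ) - 1) •
        fracP heatSemigroup (2 / 3) (1 / 2 - s) (windowB s (u s))) ∧
      (∀ u, T₂ u = ∫ s in (1 / 2 : ℝ)..1, (1 - s) ^ ((2 / 3 : ℝ) - 1) •
        fracP heatSemigroup (2 / 3) (1 - s) (windowB s (u s))) := by
  obtain ⟨A, hA⟩ := exists_fracS_heat_CLM (α := 2 / 3) (t := 1 / 2) (by norm_num) (by norm_num)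
    (by norm_num)
  obtain ⟨T₁, h₁⟩ := exists_control_CLM (α := 2 / 3) (τ := 0) (t :=
    1 / 2) (by norm_num) (by norm_num)
    (by norm_num) (by norm_num) (by norm_num)
  obtain ⟨T₂, h₂⟩ := exists_control_CLM (α := 2 / 3) (τ := 1 / 2) (t :=
    1) (by norm_num) (by norm_num)
    (by norm_num) (by norm_num) (by norm_num)
  exact ⟨A, T₁, T₂, hA, h₁, h₂⟩

/-- `y(1)` as an affine function of the control. -/
lemma heatSystem_mildSolution_one_eq {A : L2Pi →L[ℝ] L2Pi}
    {T₁ T₂ : Lp L2Pi 2 (volume.restrict (Icc (0 : ℝ) 1)) →L[ℝ] L2Pi}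
    (hA : ∀ x, A x = fracS heatSemigroup (2 / 3) (1 / 2) x)
    (h₁ : ∀ u, T₁ u = ∫ s in (0 : ℝ)..(1 / 2), (1 / 2 - s) ^ ((2 / 3 : ℝ) - 1) •
      fracP heatSemigroup (2 / 3) (1 / 2 - s) (windowB s (u s)))
    (h₂ : ∀ u, T₂ u = ∫ s in (1 / 2 : ℝ)..1, (1 - s) ^ ((2 / 3 : ℝ) - 1) •
      fracP heatSemigroup (2 / 3) (1 - s) (windowB s (u s)))
    (x₀ : L2Pi) (u : Lp L2Pi 2 (volume.restrict (Icc (0 : ℝ) 1))) (v : Fin 2 → L2Pi) :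
    heatSystem.mildSolution x₀ u v 1 1 =
      A ((2 : ℝ) • A x₀ + v 0) + ((2 : ℝ) • A (T₁ u) + T₂ u) := by
  rw [heatSystem_mildSolution_one, heatSystem_postImpulse_one, heatSystem_evolve, heatSystem_evolve,
    ← h₁, ← h₂, sub_zero, show (1 : ℝ) - 1 / 2 = 1 / 2 by norm_num, ← hA, ← hA]
  simp only [map_add, map_smul, smul_add]
  abel

/-- An operator on the control space that adds `v₂` to a bounded linear expression in `u` and `v₁`
is bounded and onto, so its adjoint is injective. -/
lemma exists_controllability_CLM (L : Lp L2Pi 2 (volume.restrict (Icc (0 : ℝ) 1)) →L[ℝ] L2Pi)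
    (N : L2Pi →L[ℝ] L2Pi) {f : ControlSpace L2Pi 2 1 → L2Pi}
    (hf : ∀ Ω, f Ω = L Ω.fst + N (Ω.snd 0) + Ω.snd 1) :
    ∃ M : ControlSpace L2Pi 2 1 →L[ℝ] L2Pi, (∀ Ω, M Ω = f Ω) ∧
      (∀ h : L2Pi, ContinuousLinearMap.adjoint M h = 0 → h = 0) ∧ range M = univ := by
  let P₁ : ControlSpace L2Pi 2 1 →L[ℝ] Lp L2Pi 2 (volume.restrict (Icc (0 : ℝ) 1)) :=
    WithLp.fstL 2 ℝ _ _
  let P₂ : ControlSpace L2Pi 2 1 →L[ℝ] PiLp 2 (fun _ : Fin 2 => L2Pi) := WithLp.sndL 2 ℝ _ _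
  let M : ControlSpace L2Pi 2 1 →L[ℝ] L2Pi :=
    L ∘L P₁ + N ∘L (PiLp.proj 2 (fun _ : Fin 2 => L2Pi) 0) ∘L P₂ +
      (PiLp.proj 2 (fun _ : Fin 2 => L2Pi) 1) ∘L P₂
  have hM : ∀ Ω, M Ω = L Ω.fst + N (Ω.snd 0) + Ω.snd 1 := fun Ω => rfl
  have hsurj : Function.Surjective M := fun y =>
    ⟨WithLp.toLp 2 (0, WithLp.toLp 2 ![0, y]), by rw [hM]; simp⟩
  exact ⟨M, fun Ω => by rw [hM, hf], adjoint_injective_of_surjective M hsurj, hsurj.range_eq⟩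

lemma exists_controllabilityMap_CLM :
    ∃ M : ControlSpace L2Pi 2 1 →L[ℝ] L2Pi, (∀ Ω, M Ω = heatSystem.controllabilityMap Ω) ∧
      (∀ h : L2Pi, ContinuousLinearMap.adjoint M h = 0 → h = 0) ∧ range M = univ := by
  obtain ⟨A, T₁, T₂, hA, h₁, h₂⟩ := exists_heat_solution_CLMs
  refine exists_controllability_CLM ((2 : ℝ) • ((2 : ℝ) • A ∘L T₁ + T₂)) ((2 : ℝ) • A) fun Ω => ?_
  rw [heatSystem_controllabilityMap, heatSystem_postImpulse_two,
    heatSystem_mildSolution_one_eq hA h₁ h₂]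
  simp
  abel

lemma exists_heatExplicitMap_CLM :
    ∃ M : ControlSpace L2Pi 2 1 →L[ℝ] L2Pi, (∀ Ω, M Ω = heatExplicitMap Ω) ∧
      (∀ h : L2Pi, ContinuousLinearMap.adjoint M h = 0 → h = 0) ∧ range M = univ := by
  obtain ⟨A, T₁, T₂, hA, h₁, h₂⟩ := exists_heat_solution_CLMs
  refine exists_controllability_CLM (T₂ + (2 : ℝ) • A ∘L T₁) A fun Ω => ?_
  rw [add_apply, smul_apply, ContinuousLinearMap.comp_apply, h₁, h₂, hA, hA,
    show (2 / 3 : ℝ) - 1 = -(1 / 3) by norm_num, heatExplicitMap]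

/-- With fixed impulses the states `y(1)`, and hence the states `y(1⁺) = 2 y(1) + v₂`, are dense:
they form a translate of the range of a bounded operator that reaches every sine mode. -/
lemma dense_reachable_states (y₀ : L2Pi) (v : Fin 2 → L2Pi) :
    (DenseRange fun u : Lp L2Pi 2 (volume.restrict (Icc (0 : ℝ) 1)) =>
      heatSystem.mildSolution y₀ u v 1 1) ∧
    DenseRange fun u : Lp L2Pi 2 (volume.restrict (Icc (0 : ℝ) 1)) =>
      heatSystem.postImpulse y₀ u v 2 := by
  obtain ⟨A, T₁, T₂, hA, h₁, h₂⟩ := exists_heat_solution_CLMs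
  have hdense : DenseRange ((2 : ℝ) • A ∘L T₁ + T₂) := by
    refine denseRange_of_reaches_sineModes _ fun n => ?_
    obtain ⟨u, κ, hκ, hu₁, hu₂⟩ := exists_control_reaching_sineMode (α := 2 / 3) (τ := 1 / 2)
      (by norm_num) (by norm_num) (by norm_num) (by norm_num) n
    refine ⟨u, κ, hκ, ?_⟩
    rw [add_apply, smul_apply, ContinuousLinearMap.comp_apply, (h₁ u).trans hu₁, (h₂ u).trans hu₂,
      map_zero, smul_zero, zero_add]
  have hstate : DenseRange fun u : Lp L2Pi 2 (volume.restrict (Icc (0 : ℝ) 1)) =>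
      heatSystem.mildSolution y₀ u v 1 1 := by
    simp only [heatSystem_mildSolution_one_eq hA h₁ h₂]
    exact (Homeomorph.addLeft (A ((2 : ℝ) • A y₀ + v 0))).surjective.denseRange.comp hdense
      (Homeomorph.addLeft _).continuous
  refine ⟨hstate, ?_⟩
  simp only [heatSystem_postImpulse_two]
  have hsurj : Function.Surjective fun x : L2Pi => (2 : ℝ) • x + v 1 := fun y =>
    ⟨(2 : ℝ)⁻¹ • (y - v 1), by simp⟩
  exact hsurj.denseRange.comp hstate (by fun_prop)

theorem mainTheorem11 :
    -- the semigroup in the mild solution is the one generated by the Dirichlet Laplacian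
    IsC0Semigroup heatSemigroup ∧
    IsGeneratorOf dirichletLaplacian heatSemigroup ∧
    -- the control operator is bounded, with norm at most one
    (∀ t : ℝ, IsBoundedLinearMap ℝ (windowB t) ∧ ∀ w : L2Pi, ‖windowB t w‖ ≤ ‖w‖) ∧
    -- the controllability map of the system is bounded and linear, its adjoint is injective, and
    -- the system is approximately controllable on `[0, 1]`
    (∃ M : ControlSpace L2Pi 2 1 →L[ℝ] L2Pi,
      (∀ Ω, M Ω = heatSystem.controllabilityMap Ω) ∧
      ∀ h : L2Pi, ContinuousLinearMap.adjoint M h = 0 → h = 0) ∧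
    heatSystem.ApproximatelyControllable ∧
    -- the same for the explicit operator
    (∃ M : ControlSpace L2Pi 2 1 →L[ℝ] L2Pi,
      (∀ Ω, M Ω = heatExplicitMap Ω) ∧
      (∀ h : L2Pi, ContinuousLinearMap.adjoint M h = 0 → h = 0) ∧
      closure (range M) = univ) ∧
    -- with the impulses `sin`, `cos` of the equation, the states `y(1)` and `y(1⁺)` reachable
    -- through `u` alone are dense, for every initial state
    (∀ y₀ : L2Pi,
      Dense (range fun u : Lp L2Pi 2 (volume.restrict (Icc (0 : ℝ) 1)) =>
        heatSystem.mildSolution y₀ u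
          ![contL2 Real.sin Real.continuous_sin, contL2 Real.cos Real.continuous_cos] 1 1) ∧
      Dense (range fun u : Lp L2Pi 2 (volume.restrict (Icc (0 : ℝ) 1)) =>
        heatSystem.postImpulse y₀ u
          ![contL2 Real.sin Real.continuous_sin, contL2 Real.cos Real.continuous_cos] 2)) := by
  refine ⟨isC0Semigroup_heatSemigroup, isGeneratorOf_dirichletLaplacian,
    fun t => ⟨?_, norm_windowB_le t⟩, ?_, ?_, ?_, fun y₀ => dense_reachable_states y₀ _⟩
  · rw [windowB_eq_diagFun]
    exact isBoundedLinearMap_diagFun (abs_window_coeff_le t)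
  · obtain ⟨M, hM, hadj, -⟩ := exists_controllabilityMap_CLM
    exact ⟨M, hM, hadj⟩
  · obtain ⟨M, hM, -, hr⟩ := exists_controllabilityMap_CLM
    rw [FracImpulsiveSystem.ApproximatelyControllable, ← funext hM, hr, closure_univ]
  · obtain ⟨M, hM, hadj, hr⟩ := exists_heatExplicitMap_CLM
    exact ⟨M, hM, hadj, by rw [hr, closure_univ]⟩
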